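/- For $0<a<1$ let $K_a$ be the tempered distribution on $\mathbb R$ with Fourier transform $\widehat{K_a}(\xi)=\left(\frac{\tanh \xi}{\xi}\right)^{a}$ (value $1$ at $\xi=0$), where $\hat f(\xi)=\int_{\mathbb R} f(x)e^{-ix\xi}\,\mathrm{d}x$; for $f\in L^2(\mathbb R)$ the convolution $K_a*f\in L^2(\mathbb R)$ is given by $\widehat{K_a*f}=\widehat{K_a}\,\hat f$. For $\alpha>0$ let $\Psi_\alpha:\mathbb R\to[0,\infty)$ be the even function with $$\Psi_\alpha(y)=\begin{cases}\alpha y^2-\frac13 y^3, & 0\le y<\alpha,\\ \frac23\alpha^3+\alpha^2(y-\alpha)+(y-\alpha)^3, & y\ge\alpha,\end{cases}$$ let $\mathcal L^{\Psi_\alpha}$ be the space of measurable $f:\mathbb R\to\mathbb R$ with $\int_{\mathbb R}\Psi_\alpha(cf(x))\,\mathrm{d}x<\infty$ for some $c>0$ (it is contained in $L^2(\mathbb R)$), with the gauge norm $N_{\Psi_\alpha}(f)=\inf\{\lambda>0:\int_{\mathbb R}\Psi_\alpha(f(x)/\lambda)\,\mathrm{d}x\le 1\}$, and let $$J_\alpha=\sup\left\{\|K_{1/4}*f\|_{L^2(\mathbb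 R)} : f\in\mathcal L^{\Psi_\alpha},\ N_{\Psi_\alpha}(f)=1\right\}.$$ Then the map $\alpha\mapsto \alpha J_\alpha^2$ is continuous and strictly decreasing on $(0,\infty)$, and $$\lim_{\alpha\to\infty}\alpha J_\alpha^2=1,\qquad \lim_{\alpha\searrow 0}\alpha J_\alpha^2=\frac{3\tilde B^2}{2+3(\tilde B-1)+3(\tilde B-1)^3}>\frac32,$$ where $\tilde B=\frac{4}{\sqrt3}\cos\left(\frac{5\pi}{18}\right)\approx 1.48$ (precisely, $|\tilde B-1.48|<0.005$). -/

import Mathlib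

open MeasureTheory Filter Topology Set FourierTransform
open scoped ENNReal

namespace Whitham

noncomputable section

/-! ### The kernels `K_a` and the operators `f ↦ K_a * f` -/

/-- The symbol `(tanh ξ / ξ) ^ a` of the kernel `K_a`, extended continuously by `1` to `ξ = 0`.
The frequency variable `ξ` belongs to the convention `f̂(ξ) = ∫ f(x) e^{-i x ξ} dx`. -/
def symbol (a ξ : ℝ) : ℝ :=
  if ξ = 0 then 1 else (Real.tanh ξ / ξ) ^ a

theorem tanh_le_self {x : ℝ} (hx : 0 ≤ x) : Real.tanh x ≤ x := by
  have hmono : MonotoneOn (fun y : ℝ => y * Real.cosh y - Real.sinh y) (Ici 0) := by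
    have hd : ∀ y : ℝ, HasDerivAt (fun y : ℝ => y * Real.cosh y - Real.sinh y)
        (1 * Real.cosh y + y * Real.sinh y - Real.cosh y) y := fun y =>
      ((hasDerivAt_id y).mul (Real.hasDerivAt_cosh y)).sub (Real.hasDerivAt_sinh y)
    refine monotoneOn_of_deriv_nonneg (convex_Ici 0)
      (fun y _ => (hd y).continuousAt.continuousWithinAt)
      (fun y _ => (hd y).differentiableAt.differentiableWithinAt) (fun y hy => ?_)
    rw [interior_Ici] at hy
    rw [(hd y).deriv]
    have h1 : 0 ≤ Real.sinh y := Real.sinh_nonneg_iff.2 (le_of_lt hy)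
    have h2 : 0 ≤ y * Real.sinh y := mul_nonneg (le_of_lt hy) h1
    linarith
  have h := hmono (mem_Ici.2 le_rfl) hx hx
  simp only [Real.sinh_zero, zero_mul, sub_zero] at h
  rw [Real.tanh_eq_sinh_div_cosh, div_le_iff₀ (Real.cosh_pos x)]
  linarith

theorem tanh_div_self_mem (ξ : ℝ) : Real.tanh ξ / ξ ∈ Icc (0 : ℝ) 1 := by
  have key : ∀ x : ℝ, 0 ≤ x → Real.tanh x / x ∈ Icc (0 : ℝ) 1 := by
    intro x hx
    have h0 : 0 ≤ Real.tanh x := by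
      rw [Real.tanh_eq_sinh_div_cosh]
      exact div_nonneg (Real.sinh_nonneg_iff.2 hx) (Real.cosh_pos x).le
    exact ⟨div_nonneg h0 hx, div_le_one_of_le₀ (tanh_le_self hx) hx⟩
  rcases le_total 0 ξ with h | h
  · exact key ξ h
  · have := key (-ξ) (by linarith)
    rwa [Real.tanh_neg, neg_div_neg_eq] at this

theorem symbol_mem {a : ℝ} (ha : 0 ≤ a) (ξ : ℝ) : symbol a ξ ∈ Icc (0 : ℝ) 1 := by
  unfold symbol
  split_ifs
  · simp
  · have h := tanh_div_self_mem ξ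
    exact ⟨Real.rpow_nonneg h.1 a, Real.rpow_le_one h.1 h.2 ha⟩

theorem measurable_symbol (a : ℝ) : Measurable (symbol a) := by
  have ht : Measurable Real.tanh := by
    have : Real.tanh = fun x => Real.sinh x / Real.cosh x :=
      funext Real.tanh_eq_sinh_div_cosh
    rw [this]
    exact Real.measurable_sinh.div Real.measurable_cosh
  exact Measurable.ite (measurableSet_singleton (0 : ℝ)) measurable_const
    ((ht.div measurable_id).pow_const a)

/-- Mathlib's Fourier transform is `𝓕 f ν = ∫ f(x) e^{-2 π i x ν} dx`, so that the frequency `ξ`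
above is `2 π ν`. -/
theorem memLp_symbol {a : ℝ} (ha : 0 ≤ a) :
    MemLp (fun ν : ℝ => (symbol a (2 * Real.pi * ν) : ℂ)) ∞ (volume : Measure ℝ) := by
  refine memLp_top_of_bound
    (Complex.measurable_ofReal.comp
      ((measurable_symbol a).comp (measurable_const_mul _))).aestronglyMeasurable 1
    (Eventually.of_forall fun ν => ?_)
  have h := symbol_mem ha (2 * Real.pi * ν)
  rw [Complex.norm_real, Real.norm_of_nonneg h.1]
  exact h.2

/-- Convolution with `K_a` on `L²(ℝ)`. The kernel `K_a` is the tempered distribution whose Fourier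
transform is `(tanh ξ / ξ) ^ a`, and `K_a * f` is the element of `L²` with
`𝓕 (K_a * f) (ξ) = (tanh ξ / ξ) ^ a · 𝓕 f (ξ)`, for the Fourier transform on `L²`. -/
def convK (a : ℝ) (ha : 0 ≤ a) (f : Lp ℂ 2 (volume : Measure ℝ)) :
    Lp ℂ 2 (volume : Measure ℝ) :=
  𝓕⁻ (((memLp_symbol ha).toLp _ • 𝓕 f : Lp ℂ 2 (volume : Measure ℝ)))

/-! ### The Orlicz space -/

/-- The Orlicz function `Ψ` with parameter `α > 0`, extended evenly to `ℝ`. -/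
def Psi (α y : ℝ) : ℝ :=
  if |y| < α then α * |y| ^ 2 - |y| ^ 3 / 3
  else 2 / 3 * α ^ 3 + α ^ 2 * (|y| - α) + (|y| - α) ^ 3

/-- Membership in the Orlicz space `𝓛^Ψ` over `ℝ` with Lebesgue measure. -/
def MemOrlicz (Ψ : ℝ → ℝ) (f : ℝ → ℝ) : Prop :=
  AEStronglyMeasurable f volume ∧
    ∃ c : ℝ, 0 < c ∧ ∫⁻ x, ENNReal.ofReal (Ψ (c * f x)) < ∞

/-- The gauge norm `N_Ψ(f) = inf {λ > 0 : ∫ Ψ(f / λ) ≤ 1}`. -/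
def gaugeNorm (Ψ : ℝ → ℝ) (f : ℝ → ℝ) : ℝ :=
  sInf {l : ℝ | 0 < l ∧ ∫⁻ x, ENNReal.ofReal (Ψ (f x / l)) ≤ 1}

theorem Psi_ge {α : ℝ} (hα : 0 < α) (y : ℝ) : α / 3 * y ^ 2 ≤ Psi α y := by
  rw [← sq_abs y]
  have hz := abs_nonneg y
  unfold Psi
  generalize |y| = z at hz ⊢
  split_ifs with h
  · nlinarith [mul_nonneg (sq_nonneg z) (sub_nonneg.2 h.le), mul_nonneg hα.le (sq_nonneg z)]
  · obtain ⟨t, ht, rfl⟩ : ∃ t, 0 ≤ t ∧ z = α + t := ⟨z - α, by linarith, by ring⟩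
    have h3 : 0 ≤ t * (t - α / 6) ^ 2 := mul_nonneg ht (sq_nonneg _)
    have h4 : 0 ≤ t * α ^ 2 := mul_nonneg ht (sq_nonneg _)
    have h5 : 0 ≤ α ^ 3 := by positivity
    nlinarith

/-- The Orlicz space is contained in `L²`, so that `K_a * f` makes sense on all of it. -/
theorem MemOrlicz.memLp_two {α : ℝ} (hα : 0 < α) {f : ℝ → ℝ} (hf : MemOrlicz (Psi α) f) :
    MemLp f 2 volume := by
  obtain ⟨hm, c, hc, hfin⟩ := hf
  rw [memLp_two_iff_integrable_sq hm]
  have hint : Integrable (fun x => α / 3 * (c * f x) ^ 2) volume := by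
    refine ⟨((hm.const_mul c).pow 2).const_mul (α / 3), ?_⟩
    rw [hasFiniteIntegral_iff_ofReal (Eventually.of_forall fun x => by positivity)]
    exact (lintegral_mono fun x => ENNReal.ofReal_le_ofReal (Psi_ge hα _)).trans_lt hfin
  have h2 := hint.const_mul (α / 3 * c ^ 2)⁻¹
  refine h2.congr (Eventually.of_forall fun x => ?_)
  simp only
  field_simp

/-! ### The variational problem -/

/-- `J_α = sup {‖K_{1/4} * f‖_{L²} : f ∈ 𝓛^Ψ, N_Ψ(f) = 1}`, over real-valued `f`. For `α > 0` the
hypothesis `f ∈ L²` is no restriction (`MemOrlicz.memLp_two`); it only allows one to regard `f` as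
an element of the Hilbert space `L²`. -/
def J (α : ℝ) : ℝ :=
  sSup {r : ℝ | ∃ (f : ℝ → ℝ) (hf : MemLp f 2 (volume : Measure ℝ)),
    MemOrlicz (Psi α) f ∧ gaugeNorm (Psi α) f = 1 ∧
      r = ‖convK (1 / 4) (by norm_num) ((hf.ofReal (K := ℂ)).toLp _)‖}

/-- The number `B̃ = (4 / √3) cos (5 π / 18)`. -/
def B : ℝ := 4 / √3 * Real.cos (5 * Real.pi / 18)

end

end Whitham

/-!
Dilating by `α` in the values turns the variational problem for `J_α` into that of maximizing
`E(g) = ‖K_a * g‖²` subject to `∫ Ψ₁(g) ≤ s`, where `s = α⁻³`; if `F(s)` is the maximum, then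
`α J_α² = F(s) / s`.

Dilation by `t > 1` in the variable replaces `s` by `t s`. It increases the spectral weight, which
is radially strictly decreasing, hence `F(s) / s` is strictly increasing: low frequencies, where the
gain is negligible, cannot carry all the energy because `F(s) > s`. On the other hand the weight
increases at most by the factor `t ^ (2 a)`, which gives continuity.

As `s → 0`, the part of `g` where `|g|` is small has energy at most `(1 + o(1)) s` and the remaining
part has small `L¹` norm, which makes its energy `o(s)`; so `F(s) / s → 1`. As `s → ∞`, multiples of
indicator functions of long intervals show that `F(s) / s` tends to the trivial upper bound
`max y² / Ψ₁(y)`, which is attained at `y = B̃`, the root of a cubic.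
-/

namespace Whitham

noncomputable section

/-! ### Plancherel's theorem and the energy of a Fourier multiplier -/

theorem norm_sq_eq_integral_norm_sq {X F : Type*} [MeasurableSpace X] {μ : Measure X}
    [NormedAddCommGroup F] [InnerProductSpace ℂ F] (f : Lp F 2 μ) :
    ‖f‖ ^ 2 = ∫ x, ‖f x‖ ^ 2 ∂μ := by
  have h := L2.inner_def (𝕜 := ℂ) f f
  simp only [inner_self_eq_norm_sq_to_K] at h
  rw [← Complex.ofReal_inj, ← integral_complex_ofReal]
  push_cast
  exact h

section SpectralEnergy

variable {V F : Type*} [NormedAddCommGroup V] [InnerProductSpace ℝ V] [FiniteDimensional ℝ V]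
  [MeasurableSpace V] [BorelSpace V] [NormedAddCommGroup F] [InnerProductSpace ℂ F]

theorem continuous_fourier {f : V → F} (hf : Integrable f) : Continuous (𝓕 f) :=
  VectorFourier.fourierIntegral_continuous Real.continuous_fourierChar
    (L := innerₗ V) continuous_inner hf

theorem norm_fourier_le (f : V → F) (ν : V) : ‖𝓕 f ν‖ ≤ ∫ x, ‖f x‖ :=
  VectorFourier.norm_fourierIntegral_le_integral_norm _ _ _ _ _

theorem fourier_add_apply {f g : V → F} (hf : Integrable f) (hg : Integrable g) (ν : V) :
    𝓕 (f + g) ν = 𝓕 f ν + 𝓕 g ν := by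
  simp only [Real.fourier_eq, Pi.add_apply, smul_add]
  exact integral_add ((Real.fourierIntegral_convergent_iff ν).2 hf)
    ((Real.fourierIntegral_convergent_iff ν).2 hg)

theorem fourier_comp_inv_smul {t : ℝ} (ht : 0 < t) (f : V → F) (ν : V) :
    𝓕 (fun x => f (t⁻¹ • x)) ν = (t ^ Module.finrank ℝ V) • 𝓕 f (t • ν) := by
  rw [Real.fourier_eq, Real.fourier_eq, ← Measure.integral_comp_inv_smul_of_nonneg _ _ ht.le]
  simp only [real_inner_smul_left, real_inner_smul_right, mul_inv_cancel_left₀ ht.ne']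

/-- The energy `∫ w |𝓕 f|²` of `f` with respect to the spectral weight `w`, that is, the squared
`L²` norm of the image of `f` under the Fourier multiplier `√w`. -/
def spectralEnergy (w : V → ℝ) (f : V → F) : ℝ := ∫ ν, w ν * ‖𝓕 f ν‖ ^ 2

theorem spectralEnergy_comp_inv_smul {t : ℝ} (ht : 0 < t) (w : V → ℝ) (f : V → F) :
    spectralEnergy w (fun x => f (t⁻¹ • x))
      = t ^ Module.finrank ℝ V * spectralEnergy (fun ν => w (t⁻¹ • ν)) f := by
  have rescaled : ∀ ν, w ν * ‖𝓕 (fun x => f (t⁻¹ • x)) ν‖ ^ 2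
      = (t ^ Module.finrank ℝ V) ^ 2 * (w (t⁻¹ • t • ν) * ‖𝓕 f (t • ν)‖ ^ 2) := fun ν => by
    rw [fourier_comp_inv_smul ht, norm_smul, Real.norm_of_nonneg (by positivity),
      inv_smul_smul₀ ht.ne']
    ring
  simp only [spectralEnergy, rescaled]
  rw [integral_const_mul, Measure.integral_comp_smul_of_nonneg volume
    (fun ν => w (t⁻¹ • ν) * ‖𝓕 f ν‖ ^ 2) t (hR := ht.le), smul_eq_mul, ← mul_assoc, sq,
    mul_inv_cancel_right₀ (by positivity)]

variable [CompleteSpace F]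

theorem fourier_toLp_ae_eq {f : V → F} (h1 : Integrable f) (h2 : MemLp f 2 volume) :
    (𝓕 (h2.toLp f) : Lp F 2 (volume : Measure V)) =ᵐ[volume] 𝓕 f := by
  refine ae_eq_of_integral_contDiff_smul_eq ((Lp.memLp _).locallyIntegrable (by norm_num))
    (continuous_fourier h1).locallyIntegrable fun g hg hg_supp => ?_
  let G := (hg_supp.comp_left Complex.ofReal_zero).toSchwartzMap
    (Complex.ofRealCLM.contDiff.comp hg)
  have pairing : ∫ ξ, G ξ • (𝓕 (h2.toLp f) : Lp F 2 (volume : Measure V)) ξ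
      = ∫ x, (𝓕 (G : V → ℂ) x) • (h2.toLp f) x := by
    have h := congrArg (fun T => T G) (Lp.fourier_toTemperedDistribution_eq (h2.toLp f))
    simpa only [TemperedDistribution.fourier_apply, Lp.toTemperedDistribution_apply,
      SchwartzMap.fourier_coe] using h.symm
  have representative : ∫ x, (𝓕 (G : V → ℂ) x) • (h2.toLp f) x = ∫ x, (𝓕 (G : V → ℂ) x) • f x :=
    integral_congr_ae (h2.coeFn_toLp.mono fun x hx => congrArg (_ • ·) hx)
  have multiplication_formula : ∫ x, (𝓕 (G : V → ℂ) x) • f x = ∫ ξ, G ξ • 𝓕 f ξ := by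
    have h := VectorFourier.integral_fourierIntegral_smul_eq_flip (L := innerₗ V) (μ := volume)
      (ν := volume) Real.continuous_fourierChar continuous_inner G.integrable h1
    rwa [flip_innerₗ] at h
  exact pairing.trans (representative.trans multiplication_formula)

theorem memLp_fourier {f : V → F} (h1 : Integrable f) (h2 : MemLp f 2 volume) :
    MemLp (𝓕 f) 2 volume :=
  (memLp_congr_ae (fourier_toLp_ae_eq h1 h2)).1 (Lp.memLp _)

theorem integrable_norm_fourier_sq {f : V → F} (h1 : Integrable f) (h2 : MemLp f 2 volume) :
    Integrable fun ν => ‖𝓕 f ν‖ ^ 2 :=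
  (memLp_fourier h1 h2).norm.integrable_sq

theorem integral_norm_fourier_sq {f : V → F} (h1 : Integrable f) (h2 : MemLp f 2 volume) :
    ∫ ν, ‖𝓕 f ν‖ ^ 2 = ∫ x, ‖f x‖ ^ 2 :=
  calc ∫ ν, ‖𝓕 f ν‖ ^ 2 = ∫ ν, ‖(𝓕 (h2.toLp f) : Lp F 2 (volume : Measure V)) ν‖ ^ 2 :=
        integral_congr_ae ((fourier_toLp_ae_eq h1 h2).mono fun ν hν => by simp only [hν])
    _ = ∫ x, ‖h2.toLp f x‖ ^ 2 := by
        rw [← norm_sq_eq_integral_norm_sq, Lp.norm_fourier_eq, norm_sq_eq_integral_norm_sq]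
    _ = ∫ x, ‖f x‖ ^ 2 := integral_congr_ae (h2.coeFn_toLp.mono fun x hx => by simp only [hx])

theorem integrable_mul_norm_fourier_sq {w : V → ℝ} (hw : Measurable w)
    (hw_mem : ∀ ν, w ν ∈ Icc (0 : ℝ) 1) {f : V → F} (h1 : Integrable f) (h2 : MemLp f 2 volume) :
    Integrable fun ν => w ν * ‖𝓕 f ν‖ ^ 2 :=
  (integrable_norm_fourier_sq h1 h2).bdd_mul (c := 1) hw.aestronglyMeasurable
    (Eventually.of_forall fun ν => by rw [Real.norm_of_nonneg (hw_mem ν).1]; exact (hw_mem ν).2)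

theorem mul_spectralEnergy_le_add {w u v : V → ℝ} {c κ : ℝ} (hc : 0 ≤ c) (hw : ∀ ν, 0 ≤ w ν)
    (hu : Measurable u) (hu_mem : ∀ ν, u ν ∈ Icc (0 : ℝ) 1) (hv : Measurable v)
    (hv_mem : ∀ ν, v ν ∈ Icc (0 : ℝ) 1) (hle : ∀ ν, c * w ν ≤ u ν + κ * v ν) {f : V → F}
    (h1 : Integrable f) (h2 : MemLp f 2 volume) :
    c * spectralEnergy w f ≤ spectralEnergy u f + κ * spectralEnergy v f := by
  have int_u := integrable_mul_norm_fourier_sq hu hu_mem h1 h2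
  have int_v := (integrable_mul_norm_fourier_sq hv hv_mem h1 h2).const_mul κ
  simp only [spectralEnergy]
  rw [← integral_const_mul, ← integral_const_mul, ← integral_add int_u int_v]
  refine integral_mono_of_nonneg
    (Eventually.of_forall fun ν => mul_nonneg hc (mul_nonneg (hw ν) (sq_nonneg _)))
    (int_u.add int_v) (Eventually.of_forall fun ν => ?_)
  simp only [← mul_assoc, ← add_mul]
  exact mul_le_mul_of_nonneg_right (hle ν) (sq_nonneg _)

theorem spectralEnergy_le_integral {w : V → ℝ} (hw_mem : ∀ ν, w ν ∈ Icc (0 : ℝ) 1) {f : V → F}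
    (h1 : Integrable f) (h2 : MemLp f 2 volume) : spectralEnergy w f ≤ ∫ x, ‖f x‖ ^ 2 := by
  rw [← integral_norm_fourier_sq h1 h2]
  exact integral_mono_of_nonneg
    (Eventually.of_forall fun ν => mul_nonneg (hw_mem ν).1 (sq_nonneg _))
    (integrable_norm_fourier_sq h1 h2)
    (Eventually.of_forall fun ν => mul_le_of_le_one_left (sq_nonneg _) (hw_mem ν).2)

theorem spectralEnergy_le_of_le_off {w : V → ℝ} (hw_mem : ∀ ν, w ν ∈ Icc (0 : ℝ) 1) {K : Set V}
    (hK : MeasurableSet K) (hK_fin : volume K ≠ ∞) {θ : ℝ} (hθ : 0 ≤ θ) (hwθ : ∀ ν ∉ K, w ν ≤ θ)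
    {f : V → F} (h1 : Integrable f) (h2 : MemLp f 2 volume) :
    spectralEnergy w f ≤ volume.real K * (∫ x, ‖f x‖) ^ 2 + θ * ∫ x, ‖f x‖ ^ 2 := by
  have on_K : Integrable (K.indicator fun _ : V => (∫ x, ‖f x‖) ^ 2) :=
    (integrable_indicator_iff hK).2 (integrableOn_const hK_fin)
  have off_K : Integrable fun ν => θ * ‖𝓕 f ν‖ ^ 2 := (integrable_norm_fourier_sq h1 h2).const_mul θ
  calc spectralEnergy w f
      ≤ ∫ ν, (K.indicator (fun _ : V => (∫ x, ‖f x‖) ^ 2) ν + θ * ‖𝓕 f ν‖ ^ 2) := by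
        refine integral_mono_of_nonneg
          (Eventually.of_forall fun ν => mul_nonneg (hw_mem ν).1 (sq_nonneg _)) (on_K.add off_K)
          (Eventually.of_forall fun ν => ?_)
        by_cases hν : ν ∈ K
        · have h := pow_le_pow_left₀ (norm_nonneg _) (norm_fourier_le f ν) 2
          simp only [indicator_of_mem hν]
          exact (mul_le_of_le_one_left (sq_nonneg _) (hw_mem ν).2).trans
            (h.trans (le_add_of_nonneg_right (by positivity)))
        · simp only [indicator_of_notMem hν, zero_add]
          exact mul_le_mul_of_nonneg_right (hwθ ν hν) (sq_nonneg _)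
    _ = _ := by
        rw [integral_add on_K off_K, integral_const_mul, integral_norm_fourier_sq h1 h2,
          integral_indicator_const _ hK, smul_eq_mul]

theorem spectralEnergy_add_le {w : V → ℝ} (hw : Measurable w) (hw_mem : ∀ ν, w ν ∈ Icc (0 : ℝ) 1)
    {f g : V → F} (hf1 : Integrable f) (hf2 : MemLp f 2 volume) (hg1 : Integrable g)
    (hg2 : MemLp g 2 volume) {η : ℝ} (hη : 0 < η) :
    spectralEnergy w (f + g) ≤ (1 + η) * spectralEnergy w f + (1 + η⁻¹) * spectralEnergy w g := by
  have young : ∀ u v : F, ‖u + v‖ ^ 2 ≤ (1 + η) * ‖u‖ ^ 2 + (1 + η⁻¹) * ‖v‖ ^ 2 := fun u v =>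
    calc ‖u + v‖ ^ 2 ≤ (‖u‖ + ‖v‖) ^ 2 := by gcongr; exact norm_add_le u v
      _ ≤ (‖u‖ + ‖v‖) ^ 2 + η * (‖u‖ - η⁻¹ * ‖v‖) ^ 2 := le_add_of_nonneg_right (by positivity)
      _ = _ := by field_simp; ring
  have hf := (integrable_mul_norm_fourier_sq hw hw_mem hf1 hf2).const_mul (1 + η)
  have hg := (integrable_mul_norm_fourier_sq hw hw_mem hg1 hg2).const_mul (1 + η⁻¹)
  simp only [spectralEnergy]
  rw [← integral_const_mul, ← integral_const_mul, ← integral_add hf hg]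
  refine integral_mono_of_nonneg
    (Eventually.of_forall fun ν => mul_nonneg (hw_mem ν).1 (sq_nonneg _)) (hf.add hg)
    (Eventually.of_forall fun ν => ?_)
  have h := mul_le_mul_of_nonneg_left (young (𝓕 f ν) (𝓕 g ν)) (hw_mem ν).1
  simp only [fourier_add_apply hf1 hg1]
  linarith

end SpectralEnergy

/-! ### The symbol `tanh ξ / ξ` and its powers -/

theorem hasDerivAt_tanh (x : ℝ) : HasDerivAt Real.tanh (Real.cosh x ^ 2)⁻¹ x := by
  have h := (Real.hasDerivAt_sinh x).div (Real.hasDerivAt_cosh x) (Real.cosh_pos x).ne'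
  rw [← sq, ← sq, Real.cosh_sq_sub_sinh_sq, one_div] at h
  exact h.congr_of_eventuallyEq (Eventually.of_forall Real.tanh_eq_sinh_div_cosh)

theorem strictMono_tanh : StrictMono Real.tanh :=
  strictMono_of_hasDerivAt_pos hasDerivAt_tanh fun x => by have := Real.cosh_pos x; positivity

theorem strictMonoOn_mul_tanh_inv_mul_sub_tanh {t : ℝ} (ht : 1 < t) :
    StrictMonoOn (fun x => t * Real.tanh (t⁻¹ * x) - Real.tanh x) (Ici 0) := by
  have ht0 : 0 < t := one_pos.trans ht
  have deriv_formula : ∀ x : ℝ, HasDerivAt (fun x => t * Real.tanh (t⁻¹ * x) - Real.tanh x)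
      ((Real.cosh (t⁻¹ * x) ^ 2)⁻¹ - (Real.cosh x ^ 2)⁻¹) x := fun x => by
    have h := (((hasDerivAt_tanh (t⁻¹ * x)).comp x
      ((hasDerivAt_id x).const_mul t⁻¹)).const_mul t).sub
      (hasDerivAt_tanh x)
    rwa [mul_one, mul_comm _ t⁻¹, mul_inv_cancel_left₀ ht0.ne'] at h
  refine strictMonoOn_of_deriv_pos (convex_Ici 0)
    (fun x _ => (deriv_formula x).continuousAt.continuousWithinAt) fun x hx => ?_
  rw [interior_Ici, mem_Ioi] at hx
  have cosh_lt : Real.cosh (t⁻¹ * x) < Real.cosh x := by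
    rw [Real.cosh_lt_cosh, abs_of_pos (by positivity), abs_of_pos hx]
    exact mul_lt_of_lt_one_left hx (inv_lt_one_of_one_lt₀ ht)
  have := Real.cosh_pos (t⁻¹ * x)
  rw [(deriv_formula x).deriv, sub_pos]
  gcongr

theorem symbol_eq_symbol_one_rpow (a ξ : ℝ) : symbol a ξ = symbol 1 ξ ^ a := by
  unfold symbol
  split_ifs <;> simp

theorem symbol_abs (a ξ : ℝ) : symbol a |ξ| = symbol a ξ := by
  rcases abs_choice ξ with h | h <;> rw [h]
  simp [symbol, Real.tanh_neg, neg_div_neg_eq]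

theorem symbol_one_of_ne_zero {x : ℝ} (hx : x ≠ 0) : symbol 1 x = Real.tanh x / x := by
  rw [symbol, if_neg hx, Real.rpow_one]

theorem exp_neg_sq_half_le_symbol_one (x : ℝ) : Real.exp (-(x ^ 2 / 2)) ≤ symbol 1 x := by
  rw [← sq_abs, ← symbol_abs]
  rcases (abs_nonneg x).eq_or_lt with hx | hx
  · simp [← hx, symbol]
  rw [symbol_one_of_ne_zero hx.ne', Real.tanh_eq_sinh_div_cosh, le_div_iff₀ hx,
    le_div_iff₀ (Real.cosh_pos _)]
  calc Real.exp (-(|x| ^ 2 / 2)) * |x| * Real.cosh |x|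
      ≤ Real.exp (-(|x| ^ 2 / 2)) * |x| * Real.exp (|x| ^ 2 / 2) := by
        gcongr; exact Real.cosh_le_exp_half_sq _
    _ = |x| := by rw [mul_right_comm, ← Real.exp_add, neg_add_cancel, Real.exp_zero, one_mul]
    _ ≤ Real.sinh |x| := Real.self_le_sinh_iff.2 hx.le

theorem symbol_one_le_inv_abs {x : ℝ} (hx : x ≠ 0) : symbol 1 x ≤ |x|⁻¹ := by
  rw [← symbol_abs, symbol_one_of_ne_zero (abs_ne_zero.2 hx), ← one_div]
  gcongr
  exact (Real.tanh_lt_one _).le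

theorem symbol_one_inv_mul_le {t : ℝ} (ht : 1 ≤ t) (x : ℝ) :
    symbol 1 (t⁻¹ * x) ≤ t * symbol 1 x := by
  have ht0 : 0 < t := one_pos.trans_le ht
  rw [← symbol_abs, ← symbol_abs 1 x, abs_mul, abs_of_pos (inv_pos.2 ht0)]
  rcases (abs_nonneg x).eq_or_lt with hx | hx
  · simpa [← hx, symbol] using ht
  rw [symbol_one_of_ne_zero (by positivity), symbol_one_of_ne_zero hx.ne',
    div_le_iff₀ (by positivity)]
  calc Real.tanh (t⁻¹ * |x|) ≤ Real.tanh |x| :=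
        strictMono_tanh.monotone (mul_le_of_le_one_left hx.le (inv_le_one_of_one_le₀ ht))
    _ = t * (Real.tanh |x| / |x|) * (t⁻¹ * |x|) := by field_simp

/-- The gap is `c = t tanh (ε / t) - tanh ε`; since `tanh < 1`, it can be multiplied by `tanh`. -/
theorem exists_mul_symbol_one_le {t : ℝ} (ht : 1 < t) {ε : ℝ} (hε : 0 < ε) :
    ∃ c > 0, ∀ x, ε ≤ |x| → (1 + c) * symbol 1 x ≤ symbol 1 (t⁻¹ * x) := by
  have ht0 : 0 < t := one_pos.trans ht
  have mono := strictMonoOn_mul_tanh_inv_mul_sub_tanh ht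
  have gap_pos : 0 < t * Real.tanh (t⁻¹ * ε) - Real.tanh ε := by
    simpa using mono self_mem_Ici hε.le hε
  refine ⟨_, gap_pos, fun x hx => ?_⟩
  rw [← symbol_abs, ← symbol_abs 1 (t⁻¹ * x), abs_mul, abs_of_pos (inv_pos.2 ht0)]
  have hx0 : 0 < |x| := hε.trans_le hx
  have gap_le : t * Real.tanh (t⁻¹ * ε) - Real.tanh ε ≤ t * Real.tanh (t⁻¹ * |x|) - Real.tanh |x| :=
    mono.monotoneOn hε.le hx0.le hx
  rw [symbol_one_of_ne_zero hx0.ne', symbol_one_of_ne_zero (by positivity)]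
  calc (1 + (t * Real.tanh (t⁻¹ * ε) - Real.tanh ε)) * (Real.tanh |x| / |x|)
      ≤ t * Real.tanh (t⁻¹ * |x|) / |x| := by
        rw [← mul_div_assoc]
        refine div_le_div_of_nonneg_right ?_ hx0.le
        linarith [mul_le_mul_of_nonneg_left (Real.tanh_lt_one |x|).le gap_pos.le]
    _ = Real.tanh (t⁻¹ * |x|) / (t⁻¹ * |x|) := by field_simp

/-- The spectral density `(tanh ξ / ξ) ^ (2 a)` of `‖K_a * f‖²`, where `ξ = 2 π ν` because Mathlib's
Fourier transform is `𝓕 f ν = ∫ f(x) e^{-2 π i x ν} dx`. -/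
def weight (a ν : ℝ) : ℝ := symbol a (2 * Real.pi * ν) ^ 2

theorem weight_eq_rpow (a ν : ℝ) : weight a ν = symbol 1 (2 * Real.pi * ν) ^ (2 * a) := by
  rw [weight, symbol_eq_symbol_one_rpow, mul_comm 2 a,
    ← Real.rpow_mul_natCast (symbol_mem zero_le_one _).1, Nat.cast_ofNat]

theorem measurable_weight (a : ℝ) : Measurable (weight a) :=
  ((measurable_symbol a).comp (measurable_const_mul _)).pow_const 2

section Weight

variable {a : ℝ} (ha : 0 ≤ a)
include ha

theorem weight_mem (ν : ℝ) : weight a ν ∈ Icc (0 : ℝ) 1 := by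
  have h := symbol_mem ha (2 * Real.pi * ν)
  exact ⟨sq_nonneg _, pow_le_one₀ h.1 h.2⟩

theorem one_sub_weight_le (ν : ℝ) : 1 - weight a ν ≤ a * (2 * Real.pi * ν) ^ 2 := by
  have h : Real.exp (-(a * (2 * Real.pi * ν) ^ 2)) ≤ weight a ν :=
    calc Real.exp (-(a * (2 * Real.pi * ν) ^ 2))
        = Real.exp (-((2 * Real.pi * ν) ^ 2 / 2)) ^ (2 * a) := by rw [← Real.exp_mul]; ring_nf
      _ ≤ weight a ν := by
          rw [weight_eq_rpow]; gcongr; exact exp_neg_sq_half_le_symbol_one _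
  linarith [Real.add_one_le_exp (-(a * (2 * Real.pi * ν) ^ 2))]

theorem weight_le_of_le_abs {R : ℝ} (hR : 0 < R) {ν : ℝ} (hν : R ≤ |ν|) :
    weight a ν ≤ R⁻¹ ^ (2 * a) := by
  have hν0 : ν ≠ 0 := abs_pos.1 (hR.trans_le hν)
  rw [weight_eq_rpow]
  refine Real.rpow_le_rpow (symbol_mem zero_le_one _).1
    ((symbol_one_le_inv_abs (by positivity)).trans ?_) (by positivity)
  rw [abs_mul, abs_of_pos Real.two_pi_pos]
  gcongr
  nlinarith [Real.pi_gt_three]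

theorem weight_inv_mul_le {t : ℝ} (ht : 1 ≤ t) (ν : ℝ) :
    weight a (t⁻¹ * ν) ≤ t ^ (2 * a) * weight a ν := by
  have h0 := (symbol_mem zero_le_one (2 * Real.pi * ν)).1
  rw [weight_eq_rpow, weight_eq_rpow, ← Real.mul_rpow (by positivity) h0, mul_left_comm]
  exact Real.rpow_le_rpow (symbol_mem zero_le_one _).1 (symbol_one_inv_mul_le ht _) (by positivity)

end Weight

theorem exists_mul_weight_le {a : ℝ} (ha : 0 < a) {t : ℝ} (ht : 1 < t) {ε : ℝ} (hε : 0 < ε) :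
    ∃ κ > 0, ∀ ν, ε ≤ |ν| → (1 + κ) * weight a ν ≤ weight a (t⁻¹ * ν) := by
  obtain ⟨c, hc, h⟩ := exists_mul_symbol_one_le ht hε
  refine ⟨(1 + c) ^ (2 * a) - 1,
    sub_pos.2 (Real.one_lt_rpow (by linarith) (by positivity)), fun ν hν => ?_⟩
  have h0 := (symbol_mem zero_le_one (2 * Real.pi * ν)).1
  rw [add_sub_cancel, weight_eq_rpow, weight_eq_rpow, ← Real.mul_rpow (by positivity) h0,
    mul_left_comm (2 * Real.pi)]
  gcongr
  refine h _ (hν.trans ?_)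
  rw [abs_mul, abs_of_pos Real.two_pi_pos]
  nlinarith [Real.pi_gt_three, abs_nonneg ν]

theorem weight_le_weight_inv_mul {a : ℝ} (ha : 0 < a) {t : ℝ} (ht : 1 < t) (ν : ℝ) :
    weight a ν ≤ weight a (t⁻¹ * ν) := by
  rcases eq_or_ne ν 0 with rfl | hν
  · rw [mul_zero]
  obtain ⟨κ, hκ, h⟩ := exists_mul_weight_le ha ht (abs_pos.2 hν)
  exact (le_mul_of_one_le_left (weight_mem ha.le ν).1 (by linarith)).trans (h ν le_rfl)

/-! ### Indicator functions of intervals -/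

section Indicator

variable {F : Type*} [NormedAddCommGroup F] [InnerProductSpace ℂ F] [CompleteSpace F]

theorem fourier_indicator_Ioc {b c : ℝ} (hbc : b ≤ c) (z : F) (ν : ℝ) :
    𝓕 ((Ioc b c).indicator fun _ => z) ν
      = (∫ x in b..c, Complex.exp ((-(2 * Real.pi * ν) * Complex.I : ℂ) * x)) • z := by
  rw [intervalIntegral.integral_of_le hbc, ← integral_smul_const,
    ← integral_indicator measurableSet_Ioc, Real.fourier_real_eq_integral_exp_smul]
  congr 1 with x
  by_cases hx : x ∈ Ioc b c
  · simp only [indicator_of_mem hx]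
    push_cast
    ring_nf
  · simp only [indicator_of_notMem hx, smul_zero]

theorem norm_fourier_indicator_Ioc_le {b c : ℝ} (hbc : b ≤ c) (z : F) {ν : ℝ} (hν : ν ≠ 0) :
    ‖𝓕 ((Ioc b c).indicator fun _ => z) ν‖ ≤ (Real.pi * |ν|)⁻¹ * ‖z‖ := by
  have norm_exp : ∀ x : ℝ,
      ‖Complex.exp ((-(2 * Real.pi * ν) * Complex.I : ℂ) * x)‖ = 1 := fun x => by
    rw [Complex.norm_exp]; simp
  have norm_coeff : ‖(-(2 * Real.pi * ν) * Complex.I : ℂ)‖ = 2 * (Real.pi * |ν|) := by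
    simp [abs_of_pos Real.pi_pos, mul_assoc]
  rw [fourier_indicator_Ioc hbc, norm_smul,
    integral_exp_mul_complex (by simp [hν, Real.pi_ne_zero]),
    norm_div, norm_coeff]
  gcongr
  calc _ ≤ (1 + 1) / (2 * (Real.pi * |ν|)) := by
        gcongr
        exact (norm_sub_le _ _).trans_eq (by rw [norm_exp, norm_exp])
    _ = (Real.pi * |ν|)⁻¹ := by field_simp; norm_num

theorem one_sub_weight_mul_norm_fourier_indicator_sq_le {a : ℝ} (ha : 0 ≤ a) {b c : ℝ} (hbc : b ≤ c)
    (z : F) {ν : ℝ} (hν : ν ≠ 0) :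
    (1 - weight a ν) * ‖𝓕 ((Ioc b c).indicator fun _ => z) ν‖ ^ 2
      ≤ (4 * a + 1) * ‖z‖ ^ 2 * (1 + ν ^ 2)⁻¹ := by
  have w_mem := weight_mem ha ν
  have deficit : (1 - weight a ν) * (1 + ν ^ 2) ≤ (4 * a + 1) * (Real.pi * |ν|) ^ 2 := by
    rw [mul_pow, sq_abs]
    nlinarith [one_sub_weight_le ha ν, mul_nonneg w_mem.1 (sq_nonneg ν),
      mul_nonneg (sq_nonneg ν) (by nlinarith [Real.pi_gt_three] : 0 ≤ Real.pi ^ 2 - 1)]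
  calc (1 - weight a ν) * ‖𝓕 ((Ioc b c).indicator fun _ => z) ν‖ ^ 2
      ≤ (1 - weight a ν) * ((Real.pi * |ν|)⁻¹ * ‖z‖) ^ 2 := by
        gcongr
        · exact sub_nonneg.2 w_mem.2
        · exact norm_fourier_indicator_Ioc_le hbc z hν
    _ = (1 - weight a ν) * (1 + ν ^ 2) * (((Real.pi * |ν|) ^ 2)⁻¹ * ‖z‖ ^ 2 * (1 + ν ^ 2)⁻¹) := by
        field_simp
    _ ≤ (4 * a + 1) * (Real.pi * |ν|) ^ 2
          * (((Real.pi * |ν|) ^ 2)⁻¹ * ‖z‖ ^ 2 * (1 + ν ^ 2)⁻¹) := by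
        gcongr
    _ = _ := by field_simp

/-- The Fourier transform of the indicator function decays like `|ν|⁻¹`, whereas the weight is
`1 - O(ν²)`, so that the energy falls short of the `L²` norm by a bounded amount. -/
theorem le_spectralEnergy_weight_indicator_Ioc {a : ℝ} (ha : 0 ≤ a) {b c : ℝ}
    (hbc : b ≤ c) (z : F) :
    (c - b - (4 * a + 1) * Real.pi) * ‖z‖ ^ 2
      ≤ spectralEnergy (weight a) ((Ioc b c).indicator fun _ => z) := by
  set f : ℝ → F := (Ioc b c).indicator fun _ => z
  have h1 : Integrable f :=
    (integrable_indicator_iff measurableSet_Ioc).2 (integrableOn_const (by simp))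
  have h2 : MemLp f 2 volume := memLp_indicator_const 2 measurableSet_Ioc z (Or.inr (by simp))
  have total : ∫ ν, ‖𝓕 f ν‖ ^ 2 = (c - b) * ‖z‖ ^ 2 := by
    have norm_sq_f : ∀ x, ‖f x‖ ^ 2 = (Ioc b c).indicator (fun _ => ‖z‖ ^ 2) x := fun x => by
      by_cases hx : x ∈ Ioc b c <;> simp [f, hx]
    simp only [integral_norm_fourier_sq h1 h2, norm_sq_f]
    rw [integral_indicator_const _ measurableSet_Ioc, Real.volume_real_Ioc_of_le hbc, smul_eq_mul]
  have deficit : ∫ ν, (1 - weight a ν) * ‖𝓕 f ν‖ ^ 2 ≤ (4 * a + 1) * ‖z‖ ^ 2 * Real.pi := by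
    rw [← integral_univ_inv_one_add_sq, ← integral_const_mul]
    refine integral_mono_of_nonneg (Eventually.of_forall fun ν =>
      mul_nonneg (sub_nonneg.2 (weight_mem ha ν).2) (sq_nonneg _))
      (integrable_inv_one_add_sq.const_mul _) ?_
    filter_upwards [compl_mem_ae_iff.2 (measure_singleton (0 : ℝ))] with ν hν
    exact one_sub_weight_mul_norm_fourier_indicator_sq_le ha hbc z hν
  simp only [sub_mul, one_mul] at deficit
  rw [integral_sub (integrable_norm_fourier_sq h1 h2)
    (integrable_mul_norm_fourier_sq (measurable_weight a) (weight_mem ha) h1 h2), total] at deficit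
  linarith [show spectralEnergy (weight a) f = ∫ ν, weight a ν * ‖𝓕 f ν‖ ^ 2 from rfl]

end Indicator

/-! ### The Orlicz function -/

theorem Psi_nonneg {α : ℝ} (hα : 0 < α) (y : ℝ) : 0 ≤ Psi α y :=
  le_trans (by positivity) (Psi_ge hα y)

theorem Psi_zero {α : ℝ} (hα : 0 < α) : Psi α 0 = 0 := by simp [Psi, hα]

theorem Psi_abs (α y : ℝ) : Psi α |y| = Psi α y := by simp [Psi]

theorem measurable_Psi (α : ℝ) : Measurable (Psi α) := by
  unfold Psi
  exact Measurable.ite (measurableSet_lt measurable_abs measurable_const) (by fun_prop)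
    (by fun_prop)

theorem Psi_mul {α : ℝ} (hα : 0 < α) (y : ℝ) : Psi α (α * y) = α ^ 3 * Psi 1 y := by
  have abs_lt_iff : α * |y| < α ↔ |y| < 1 := mul_lt_iff_lt_one_right hα
  simp only [Psi, abs_mul, abs_of_pos hα, abs_lt_iff]
  split_ifs <;> ring

theorem Psi_indicator {X : Type*} {α : ℝ} (hα : 0 < α) (A : Set X) (g : X → ℝ) (x : X) :
    Psi α (A.indicator g x) = A.indicator (fun x => Psi α (g x)) x :=
  (congrFun (indicator_comp_of_zero (Psi_zero hα)) x).symm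

theorem integrable_Psi_and_integral_le_one {X : Type*} [MeasurableSpace X] {μ : Measure X} {α : ℝ}
    (hα : 0 < α) {f : X → ℝ} (hf : AEStronglyMeasurable f μ)
    (h : ∫⁻ x, ENNReal.ofReal (Psi α (f x)) ∂μ ≤ 1) :
    Integrable (fun x => Psi α (f x)) μ ∧ ∫ x, Psi α (f x) ∂μ ≤ 1 := by
  have hm : AEStronglyMeasurable (fun x => Psi α (f x)) μ :=
    ((measurable_Psi α).comp_aemeasurable hf.aemeasurable).aestronglyMeasurable
  have h0 : 0 ≤ᵐ[μ] fun x => Psi α (f x) := Eventually.of_forall fun x => Psi_nonneg hα _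
  refine ⟨⟨hm, (hasFiniteIntegral_iff_ofReal h0).2 (h.trans_lt ENNReal.one_lt_top)⟩, ?_⟩
  rw [integral_eq_lintegral_of_nonneg_ae h0 hm]
  exact ENNReal.toReal_le_of_le_ofReal zero_le_one (by rwa [ENNReal.ofReal_one])

theorem Psi_one_of_mem {y : ℝ} (hy : y ∈ Ico (0 : ℝ) 1) : Psi 1 y = (1 - y / 3) * y ^ 2 := by
  rw [Psi, abs_of_nonneg hy.1, if_pos hy.2]; ring

theorem Psi_one_of_le {y : ℝ} (hy : 1 ≤ y) :
    Psi 1 y = (2 + 3 * (y - 1) + 3 * (y - 1) ^ 3) / 3 := by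
  have h := abs_of_nonneg (zero_le_one.trans hy)
  rw [Psi, h, if_neg hy.not_gt]; ring

theorem one_sub_mul_sq_le_Psi_one {δ : ℝ} (hδ : δ < 1) {y : ℝ} (hy : |y| ≤ δ) :
    (1 - δ / 3) * y ^ 2 ≤ Psi 1 y := by
  rw [← Psi_abs, ← sq_abs, Psi_one_of_mem ⟨abs_nonneg y, hy.trans_lt hδ⟩]
  gcongr

theorem sq_le_three_mul_Psi_one (y : ℝ) : y ^ 2 ≤ 3 * Psi 1 y := by
  linarith [Psi_ge one_pos y]

theorem abs_le_mul_Psi_one {δ : ℝ} (hδ : 0 < δ) {y : ℝ} (hy : δ ≤ |y|) :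
    |y| ≤ 3 / δ * Psi 1 y := by
  rw [div_mul_eq_mul_div, le_div_iff₀ hδ]
  calc |y| * δ ≤ |y| * |y| := by gcongr
    _ = y ^ 2 := by rw [abs_mul_abs_self, sq]
    _ ≤ 3 * Psi 1 y := sq_le_three_mul_Psi_one y

/-! ### The maximum of `y ^ 2 / Psi 1 y` -/

theorem B_cubic : 3 * B ^ 3 - 12 * B + 8 = 0 := by
  have cos_triple := Real.cos_three_mul (5 * Real.pi / 18)
  have triple_angle : 3 * (5 * Real.pi / 18) = Real.pi - Real.pi / 6 := by ring
  have cos_eq : Real.cos (5 * Real.pi / 18) = √3 * B / 4 := by unfold B; field_simp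
  have sqrt_cubed : √3 ^ 3 = 3 * √3 := by rw [pow_succ, Real.sq_sqrt zero_le_three]
  rw [triple_angle, Real.cos_pi_sub, Real.cos_pi_div_six, cos_eq] at cos_triple
  refine (mul_eq_zero.1 (?_ : √3 * (3 * B ^ 3 - 12 * B + 8) = 0)).resolve_left (by positivity)
  linear_combination (-16) * cos_triple - B ^ 3 * sqrt_cubed

theorem B_mem : B ∈ Ioo (1.475 : ℝ) 1.485 := by
  have cubic := B_cubic
  -- The cubic also has a root between `0` and `1`, which a crude lower bound excludes.
  have lower : 1.15 < B := by
    have sqrt_lt : √3 < 1.733 := by rw [Real.sqrt_lt' (by norm_num)]; norm_num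
    have lt_cos : 1 / 2 < Real.cos (5 * Real.pi / 18) := by
      rw [← Real.cos_pi_div_three]
      have := Real.pi_pos
      exact Real.cos_lt_cos_of_nonneg_of_le_pi (by positivity) (by linarith) (by linarith)
    rw [B, div_mul_eq_mul_div, lt_div_iff₀ (by positivity)]
    linarith
  constructor
  · by_contra! hB
    nlinarith [mul_nonneg (sub_nonneg.2 lower.le) (sub_nonneg.2 hB),
      mul_nonneg (mul_nonneg (sub_nonneg.2 lower.le) (sub_nonneg.2 hB)) (by linarith : 0 ≤ B)]
  · by_contra! hB
    nlinarith [mul_nonneg (sub_nonneg.2 hB) (sub_nonneg.2 hB),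
      mul_nonneg (mul_nonneg (sub_nonneg.2 hB) (sub_nonneg.2 hB)) (by linarith : 0 ≤ B)]

/-- The maximum of `y ^ 2 / Psi 1 y`, attained at `y = B`. -/
def maxRatio : ℝ := 3 * B ^ 2 / (2 + 3 * (B - 1) + 3 * (B - 1) ^ 3)

theorem maxRatio_denom_pos : 0 < 2 + 3 * (B - 1) + 3 * (B - 1) ^ 3 := by
  have one_lt : 1 < B := by linarith [B_mem.1]
  have := pow_pos (sub_pos.2 one_lt) 3
  linarith

theorem maxRatio_eq : maxRatio = B ^ 2 / Psi 1 B := by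
  have := maxRatio_denom_pos
  rw [Psi_one_of_le (by linarith [B_mem.1]), maxRatio]
  field_simp

theorem three_halves_lt_maxRatio : 3 / 2 < maxRatio := by
  rw [maxRatio, lt_div_iff₀ maxRatio_denom_pos]
  nlinarith [B_cubic, B_mem.1, B_mem.2]

theorem sq_le_maxRatio_mul_Psi_one (y : ℝ) : y ^ 2 ≤ maxRatio * Psi 1 y := by
  rw [← Psi_abs, ← sq_abs]
  have hy := abs_nonneg y
  generalize |y| = y at hy
  rcases lt_or_ge y 1 with h | h
  · calc y ^ 2 = 3 / 2 * (2 / 3 * y ^ 2) := by ring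
      _ ≤ 3 / 2 * Psi 1 y := by
          rw [Psi_one_of_mem ⟨hy, h⟩]
          gcongr
          linarith
      _ ≤ maxRatio * Psi 1 y :=
          mul_le_mul_of_nonneg_right three_halves_lt_maxRatio.le (Psi_nonneg one_pos y)
  · rw [Psi_one_of_le h, maxRatio, div_mul_div_comm,
      le_div_iff₀ (mul_pos maxRatio_denom_pos zero_lt_three)]
    have double_root_at_B : 3 * B ^ 2 * (2 + 3 * (y - 1) + 3 * (y - 1) ^ 3)
        - y ^ 2 * ((2 + 3 * (B - 1) + 3 * (B - 1) ^ 3) * 3)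
        = 3 * ((y - B) ^ 2 * (3 * B ^ 2 * y - 4)) := by
      linear_combination (3 * y ^ 2 - 3 * B * y) * B_cubic
    have cofactor_nonneg : 0 ≤ 3 * B ^ 2 * y - 4 := by nlinarith [B_mem.1]
    linarith [mul_nonneg (sq_nonneg (y - B)) cofactor_nonneg]

/-! ### Admissible functions -/

/-- The integrable competitors of the variational problem with parameter `s`, which after rescaling
replaces `α`: the modular `∫ Psi 1 g` is at most `s`. -/
structure IsAdmissible {X : Type*} [MeasurableSpace X] (μ : Measure X) (s : ℝ) (g : X → ℝ) :
    Prop where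
  integrable : Integrable g μ
  integrable_Psi : Integrable (fun x => Psi 1 (g x)) μ
  integral_Psi_le : ∫ x, Psi 1 (g x) ∂μ ≤ s

namespace IsAdmissible

section

variable {X : Type*} [MeasurableSpace X] {μ : Measure X} {s : ℝ} {g : X → ℝ}

theorem zero (hs : 0 ≤ s) : IsAdmissible μ s fun _ => 0 where
  integrable := integrable_zero _ _ _
  integrable_Psi := by simp only [Psi_zero one_pos]; exact integrable_zero _ _ _
  integral_Psi_le := by simpa only [Psi_zero one_pos, integral_zero] using hs

theorem nonneg (h : IsAdmissible μ s g) : 0 ≤ s :=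
  (integral_nonneg fun _ => Psi_nonneg one_pos _).trans h.integral_Psi_le

theorem memLp (h : IsAdmissible μ s g) : MemLp g 2 μ := by
  rw [memLp_two_iff_integrable_sq h.integrable.1]
  refine (h.integrable_Psi.const_mul 3).mono' (h.integrable.1.pow 2)
    (Eventually.of_forall fun x => ?_)
  rw [Real.norm_of_nonneg (sq_nonneg _)]
  exact sq_le_three_mul_Psi_one (g x)

theorem integrable_ofReal (h : IsAdmissible μ s g) : Integrable (fun x => (g x : ℂ)) μ :=
  h.integrable.ofReal

theorem memLp_ofReal (h : IsAdmissible μ s g) : MemLp (fun x => (g x : ℂ)) 2 μ :=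
  h.memLp.ofReal

theorem indicator (h : IsAdmissible μ s g) {A : Set X} (hA : NullMeasurableSet A μ) :
    IsAdmissible μ s (A.indicator g) where
  integrable := h.integrable.indicator₀ hA
  integrable_Psi := by
    simp only [Psi_indicator one_pos]
    exact h.integrable_Psi.indicator₀ hA
  integral_Psi_le := by
    simp only [Psi_indicator one_pos]
    exact (integral_mono (h.integrable_Psi.indicator₀ hA) h.integrable_Psi
      (indicator_le_self' fun _ _ => Psi_nonneg one_pos _)).trans h.integral_Psi_le

theorem integral_le_mul (h : IsAdmissible μ s g) {φ : ℝ → ℝ} (hφ : Integrable (fun x => φ (g x)) μ)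
    {C : ℝ} (hC : 0 ≤ C) (hφ_le : ∀ x, φ (g x) ≤ C * Psi 1 (g x)) : ∫ x, φ (g x) ∂μ ≤ C * s :=
  calc ∫ x, φ (g x) ∂μ ≤ ∫ x, C * Psi 1 (g x) ∂μ :=
        integral_mono hφ (h.integrable_Psi.const_mul C) hφ_le
    _ = C * ∫ x, Psi 1 (g x) ∂μ := integral_const_mul _ _
    _ ≤ C * s := mul_le_mul_of_nonneg_left h.integral_Psi_le hC

theorem integral_sq_le (h : IsAdmissible μ s g) {C : ℝ} (hC : 0 ≤ C)
    (hg : ∀ x, g x ^ 2 ≤ C * Psi 1 (g x)) : ∫ x, g x ^ 2 ∂μ ≤ C * s :=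
  h.integral_le_mul (φ := fun y => y ^ 2) h.memLp.integrable_sq hC hg

theorem integral_abs_le (h : IsAdmissible μ s g) {δ : ℝ} (hδ : 0 < δ)
    (hg : ∀ x, g x = 0 ∨ δ ≤ |g x|) : ∫ x, |g x| ∂μ ≤ 3 / δ * s :=
  h.integral_le_mul (φ := abs) h.integrable.abs (by positivity) fun x => by
    rcases hg x with hx | hx
    · rw [hx, Psi_zero one_pos, abs_zero, mul_zero]
    · exact abs_le_mul_Psi_one hδ hx

end

section SpectralEnergy

variable {V : Type*} [NormedAddCommGroup V] [InnerProductSpace ℝ V] [FiniteDimensional ℝ V]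
  [MeasurableSpace V] [BorelSpace V] {s : ℝ} {g : V → ℝ}

theorem comp_inv_smul (h : IsAdmissible volume s g) {t : ℝ} (ht : 0 < t) :
    IsAdmissible volume (t ^ Module.finrank ℝ V * s) fun x => g (t⁻¹ • x) where
  integrable := h.integrable.comp_smul (inv_ne_zero ht.ne')
  integrable_Psi := h.integrable_Psi.comp_smul (inv_ne_zero ht.ne')
  integral_Psi_le := by
    rw [Measure.integral_comp_inv_smul_of_nonneg volume (fun x => Psi 1 (g x)) ht.le, smul_eq_mul]
    exact mul_le_mul_of_nonneg_left h.integral_Psi_le (by positivity)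

theorem spectralEnergy_le_mul (h : IsAdmissible volume s g) {w : V → ℝ}
    (hw_mem : ∀ ν, w ν ∈ Icc (0 : ℝ) 1) {C : ℝ} (hC : 0 ≤ C)
    (hg : ∀ x, g x ^ 2 ≤ C * Psi 1 (g x)) :
    spectralEnergy w (fun x => (g x : ℂ)) ≤ C * s := by
  have le_integral := spectralEnergy_le_integral hw_mem h.integrable_ofReal h.memLp_ofReal
  simp only [Complex.norm_real, Real.norm_eq_abs, sq_abs] at le_integral
  exact le_integral.trans (h.integral_sq_le hC hg)

variable {w : V → ℝ} {K : Set V} {θ δ : ℝ}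

theorem spectralEnergy_le_of_abs_le (h : IsAdmissible volume s g)
    (hw_mem : ∀ ν, w ν ∈ Icc (0 : ℝ) 1) (hδ : δ < 1) (hg : ∀ x, |g x| ≤ δ) :
    spectralEnergy w (fun x => (g x : ℂ)) ≤ (1 - δ / 3)⁻¹ * s := by
  have hδ3 : 0 < 1 - δ / 3 := by linarith
  refine h.spectralEnergy_le_mul hw_mem (by positivity) fun x => ?_
  rw [inv_mul_eq_div, le_div_iff₀' hδ3]
  exact one_sub_mul_sq_le_Psi_one hδ (hg x)

theorem spectralEnergy_le_of_le_abs (h : IsAdmissible volume s g)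
    (hw_mem : ∀ ν, w ν ∈ Icc (0 : ℝ) 1) (hK : MeasurableSet K) (hK_fin : volume K ≠ ∞)
    (hθ : 0 ≤ θ) (hwθ : ∀ ν ∉ K, w ν ≤ θ) (hδ : 0 < δ) (hg : ∀ x, g x = 0 ∨ δ ≤ |g x|) :
    spectralEnergy w (fun x => (g x : ℂ))
      ≤ volume.real K * (3 / δ * s) ^ 2 + θ * (3 * s) := by
  have split_frequencies := spectralEnergy_le_of_le_off hw_mem hK hK_fin hθ hwθ
    h.integrable_ofReal h.memLp_ofReal
  simp only [Complex.norm_real, Real.norm_eq_abs, sq_abs] at split_frequencies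
  have l1_le := h.integral_abs_le hδ hg
  have l2_le := h.integral_sq_le zero_le_three fun x => sq_le_three_mul_Psi_one (g x)
  have l1_nonneg : 0 ≤ ∫ x, |g x| := integral_nonneg fun _ => abs_nonneg _
  exact split_frequencies.trans (add_le_add
    (mul_le_mul_of_nonneg_left (pow_le_pow_left₀ l1_nonneg l1_le 2) measureReal_nonneg)
    (mul_le_mul_of_nonneg_left l2_le hθ))

-- Where `|g| ≤ δ` the constraint almost controls the `L²` norm; the part of `g` where `|g| > δ` has
-- small `L¹` norm, so its energy in the frequency band `K` is of second order in `s`.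
theorem spectralEnergy_le (h : IsAdmissible volume s g) (hw : Measurable w)
    (hw_mem : ∀ ν, w ν ∈ Icc (0 : ℝ) 1) (hK : MeasurableSet K) (hK_fin : volume K ≠ ∞)
    (hθ : 0 ≤ θ) (hwθ : ∀ ν ∉ K, w ν ≤ θ) (hδ : δ ∈ Ioo (0 : ℝ) 1) :
    spectralEnergy w (fun x => (g x : ℂ)) ≤ (1 + 2 * δ) * s
      + (1 + δ⁻¹) * (volume.real K * (3 / δ * s) ^ 2 + θ * (3 * s)) := by
  obtain ⟨hδ0, hδ1⟩ := hδ
  set A : Set V := {x | |g x| ≤ δ}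
  have hA : NullMeasurableSet A volume :=
    nullMeasurableSet_le h.integrable.abs.aemeasurable aemeasurable_const
  have small := h.indicator hA
  have large := h.indicator hA.compl
  have small_le := small.spectralEnergy_le_of_abs_le hw_mem hδ1 fun x => by
    by_cases hx : x ∈ A
    · rwa [indicator_of_mem hx]
    · rw [indicator_of_notMem hx, abs_zero]
      exact hδ0.le
  have large_le := large.spectralEnergy_le_of_le_abs hw_mem hK hK_fin hθ hwθ hδ0 fun x => by
    by_cases hx : x ∈ A
    · exact Or.inl (indicator_of_notMem (notMem_compl_iff.2 hx) g)
    · rw [indicator_of_mem (mem_compl hx)]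
      exact Or.inr (not_le.1 hx).le
  have recombine : (fun x => ((A.indicator g x : ℝ) : ℂ)) + (fun x => ((Aᶜ.indicator g x : ℝ) : ℂ))
      = fun x => (g x : ℂ) := by
    funext x
    rw [Pi.add_apply, ← Complex.ofReal_add, ← Pi.add_apply, indicator_self_add_compl]
  have coefficient_le : (1 + δ) * (1 - δ / 3)⁻¹ ≤ 1 + 2 * δ := by
    rw [← div_eq_mul_inv, div_le_iff₀ (by linarith)]
    nlinarith
  rw [← recombine]
  refine (spectralEnergy_add_le hw hw_mem small.integrable_ofReal small.memLp_ofReal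
    large.integrable_ofReal large.memLp_ofReal hδ0).trans (add_le_add ?_ (by gcongr))
  calc (1 + δ) * spectralEnergy w (fun x => ((A.indicator g x : ℝ) : ℂ))
      ≤ (1 + δ) * ((1 - δ / 3)⁻¹ * s) := by gcongr
    _ ≤ (1 + 2 * δ) * s := by
        rw [← mul_assoc]
        exact mul_le_mul_of_nonneg_right coefficient_le h.nonneg

end SpectralEnergy

end IsAdmissible

/-! ### The rescaled variational problem -/

/-- The supremum of the spectral energy with weight `weight a`, that is, of `‖K_a * g‖ ^ 2`, over
the admissible functions `g` on `ℝ` with parameter `s`. -/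
def maxEnergy (a s : ℝ) : ℝ :=
  sSup ((fun g : ℝ → ℝ => spectralEnergy (weight a) fun x => (g x : ℂ)) ''
    {g | IsAdmissible volume s g})

section MaxEnergy

variable {a s : ℝ} {g : ℝ → ℝ}

theorem IsAdmissible.spectralEnergy_le_maxRatio_mul (ha : 0 ≤ a) (hg : IsAdmissible volume s g) :
    spectralEnergy (weight a) (fun x => (g x : ℂ)) ≤ maxRatio * s :=
  hg.spectralEnergy_le_mul (weight_mem ha) (by linarith [three_halves_lt_maxRatio])
    fun x => sq_le_maxRatio_mul_Psi_one (g x)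

theorem IsAdmissible.spectralEnergy_le_maxEnergy (ha : 0 ≤ a) (hg : IsAdmissible volume s g) :
    spectralEnergy (weight a) (fun x => (g x : ℂ)) ≤ maxEnergy a s := by
  refine le_csSup ⟨maxRatio * s, ?_⟩ ⟨g, hg, rfl⟩
  rintro _ ⟨f, hf, rfl⟩
  exact hf.spectralEnergy_le_maxRatio_mul ha

theorem maxEnergy_le (hs : 0 ≤ s) {b : ℝ}
    (hb : ∀ g, IsAdmissible volume s g → spectralEnergy (weight a) (fun x => (g x : ℂ)) ≤ b) :
    maxEnergy a s ≤ b := by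
  refine csSup_le ⟨_, _, IsAdmissible.zero hs, rfl⟩ ?_
  rintro _ ⟨g, hg, rfl⟩
  exact hb g hg

theorem maxEnergy_le_maxRatio_mul (ha : 0 ≤ a) (hs : 0 ≤ s) : maxEnergy a s ≤ maxRatio * s :=
  maxEnergy_le hs fun _ hg => hg.spectralEnergy_le_maxRatio_mul ha

theorem IsAdmissible.mul_spectralEnergy_le_maxEnergy (ha : 0 ≤ a) (hg : IsAdmissible volume s g)
    {t : ℝ} (ht : 0 < t) :
    t * spectralEnergy (fun ν => weight a (t⁻¹ * ν)) (fun x => (g x : ℂ))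
      ≤ maxEnergy a (t * s) := by
  have dilated := hg.comp_inv_smul ht
  rw [Module.finrank_self, pow_one] at dilated
  have energy_eq := spectralEnergy_comp_inv_smul ht (weight a) fun x => (g x : ℂ)
  rw [Module.finrank_self, pow_one] at energy_eq
  simp only [← smul_eq_mul (t⁻¹ : ℝ)]
  exact energy_eq.symm.le.trans (dilated.spectralEnergy_le_maxEnergy ha)

theorem isAdmissible_indicator_Ioc (hs : 0 ≤ s) {h : ℝ} (hh : 0 < h) :
    IsAdmissible volume s ((Ioc 0 (s / Psi 1 h)).indicator fun _ => h) := by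
  have finite : volume (Ioc 0 (s / Psi 1 h)) ≠ ∞ := measure_Ioc_lt_top.ne
  have hPsi : 0 < Psi 1 h := lt_of_lt_of_le (by positivity) (Psi_ge one_pos h)
  refine ⟨(integrable_indicator_iff measurableSet_Ioc).2 (integrableOn_const finite), ?_, ?_⟩ <;>
    simp only [Psi_indicator one_pos]
  · exact (integrable_indicator_iff measurableSet_Ioc).2 (integrableOn_const finite)
  · rw [integral_indicator_const _ measurableSet_Ioc,
      Real.volume_real_Ioc_of_le (div_nonneg hs hPsi.le), sub_zero, smul_eq_mul,
      div_mul_cancel₀ _ hPsi.ne']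

-- The competitor is `h` times the indicator function of an interval of length `s / Psi 1 h`.
theorem sq_div_Psi_mul_sub_le_maxEnergy (ha : 0 ≤ a) (hs : 0 ≤ s) {h : ℝ} (hh : 0 < h) :
    h ^ 2 / Psi 1 h * s - (4 * a + 1) * Real.pi * h ^ 2 ≤ maxEnergy a s := by
  have ofReal_indicator : (fun x => ((((Ioc 0 (s / Psi 1 h)).indicator fun _ => h) x : ℝ) : ℂ))
      = (Ioc 0 (s / Psi 1 h)).indicator fun _ => (h : ℂ) :=
    (indicator_comp_of_zero Complex.ofReal_zero).symm
  have energy_le := (isAdmissible_indicator_Ioc hs hh).spectralEnergy_le_maxEnergy ha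
  rw [ofReal_indicator] at energy_le
  refine le_trans (le_of_eq ?_) ((le_spectralEnergy_weight_indicator_Ioc ha
    (div_nonneg hs (Psi_nonneg one_pos h)) (h : ℂ)).trans energy_le)
  rw [Complex.norm_real, Real.norm_eq_abs, sq_abs]
  ring

theorem one_add_div_three_le_sq_div_Psi_one {h : ℝ} (hh : h ∈ Ioo (0 : ℝ) 1) :
    1 + h / 3 ≤ h ^ 2 / Psi 1 h := by
  obtain ⟨h0, h1⟩ := hh
  rw [Psi_one_of_mem ⟨h0.le, h1⟩, le_div_iff₀ (mul_pos (by linarith) (by positivity)), ← mul_assoc]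
  exact mul_le_of_le_one_left (sq_nonneg h) (by nlinarith)

theorem eventually_nhdsGT_zero_lt {f : ℝ → ℝ} (hf : ContinuousAt f 0) {b : ℝ} (hb : f 0 < b) :
    ∀ᶠ x in 𝓝[>] 0, f x < b :=
  (hf.eventually_lt_const hb).filter_mono nhdsWithin_le_nhds

theorem lt_maxEnergy (ha : 0 ≤ a) (hs : 0 < s) : s < maxEnergy a s := by
  obtain ⟨h, h2, h0, h1⟩ : ∃ h, (4 * a + 1) * Real.pi * h < s / 3 ∧ h ∈ Ioo (0 : ℝ) 1 :=
    ((eventually_nhdsGT_zero_lt (by fun_prop) (by rw [mul_zero]; positivity)).and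
      (Ioo_mem_nhdsGT one_pos)).exists
  calc s < (1 + h / 3) * s - (4 * a + 1) * Real.pi * h ^ 2 := by nlinarith
    _ ≤ h ^ 2 / Psi 1 h * s - (4 * a + 1) * Real.pi * h ^ 2 := by
        gcongr
        exact one_add_div_three_le_sq_div_Psi_one ⟨h0, h1⟩
    _ ≤ maxEnergy a s := sq_div_Psi_mul_sub_le_maxEnergy ha hs.le h0

theorem measurable_weight_inv_mul (a t : ℝ) : Measurable fun ν => weight a (t⁻¹ * ν) :=
  (measurable_weight a).comp (measurable_const_mul t⁻¹)

theorem maxEnergy_mul_le (ha : 0 ≤ a) (hs : 0 ≤ s) {t : ℝ} (ht : 1 ≤ t) :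
    maxEnergy a (t * s) ≤ t * t ^ (2 * a) * maxEnergy a s := by
  have ht0 : 0 < t := by linarith
  refine maxEnergy_le (by positivity) fun g hg => ?_
  have contracted := hg.mul_spectralEnergy_le_maxEnergy ha (inv_pos.2 ht0)
  rw [inv_mul_cancel_left₀ ht0.ne', inv_mul_le_iff₀ ht0, inv_inv] at contracted
  calc spectralEnergy (weight a) (fun x => (g x : ℂ))
      ≤ t ^ (2 * a) * spectralEnergy (fun ν => weight a (t * ν)) (fun x => (g x : ℂ)) := by
        simp only [spectralEnergy]
        rw [← integral_const_mul]
        refine integral_mono_of_nonneg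
          (Eventually.of_forall fun ν => mul_nonneg (weight_mem ha ν).1 (sq_nonneg _))
          ((integrable_mul_norm_fourier_sq ((measurable_weight a).comp (measurable_const_mul t))
            (fun ν => weight_mem ha _) hg.integrable_ofReal hg.memLp_ofReal).const_mul _)
          (Eventually.of_forall fun ν => ?_)
        have weight_le := weight_inv_mul_le ha ht (t * ν)
        rw [inv_mul_cancel_left₀ ht0.ne'] at weight_le
        simp only [← mul_assoc]
        exact mul_le_mul_of_nonneg_right weight_le (sq_nonneg _)
    _ ≤ t ^ (2 * a) * (t * maxEnergy a s) := by gcongr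
    _ = t * t ^ (2 * a) * maxEnergy a s := by ring

theorem exists_one_add_two_mul_mul_lt {b : ℝ} (hb : s < b) :
    ∃ δ : ℝ, (1 + 2 * δ) * s < b ∧ δ ∈ Ioo 0 1 :=
  ((eventually_nhdsGT_zero_lt (by fun_prop) (by rwa [mul_zero, add_zero, one_mul])).and
    (Ioo_mem_nhdsGT one_pos)).exists

theorem indicator_weight_mem (ha : 0 ≤ a) (K : Set ℝ) (ν : ℝ) :
    K.indicator (weight a) ν ∈ Icc (0 : ℝ) 1 :=
  ⟨indicator_nonneg (fun ν _ => (weight_mem ha ν).1) ν,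
    indicator_apply_le' (fun _ => (weight_mem ha ν).2) fun _ => zero_le_one⟩

theorem exists_low_frequency_energy_le (ha : 0 ≤ a) {b : ℝ} (hb : s < b) :
    ∃ ε > 0, ∀ g, IsAdmissible volume s g →
      spectralEnergy ((Icc (-ε) ε).indicator (weight a)) (fun x => (g x : ℂ)) ≤ b := by
  obtain ⟨δ, hδ_lt, hδ⟩ := exists_one_add_two_mul_mul_lt hb
  obtain ⟨ε, hε_lt, hε⟩ : ∃ ε, (1 + 2 * δ) * s
      + (1 + δ⁻¹) * (2 * ε * (3 / δ * s) ^ 2 + 0 * (3 * s)) < b ∧ ε ∈ Ioi 0 :=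
    ((eventually_nhdsGT_zero_lt (by fun_prop)
      (by simpa only [mul_zero, zero_mul, add_zero] using hδ_lt)).and self_mem_nhdsWithin).exists
  refine ⟨ε, hε, fun g hg => ?_⟩
  have energy_le := hg.spectralEnergy_le ((measurable_weight a).indicator measurableSet_Icc)
    (indicator_weight_mem ha _) (K := Icc (-ε) ε) measurableSet_Icc measure_Icc_lt_top.ne le_rfl
    (fun ν hν => (indicator_of_notMem hν _).le) hδ
  rw [Real.volume_real_Icc_of_le (by linarith [mem_Ioi.1 hε]), sub_neg_eq_add, ← two_mul]
    at energy_le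
  exact energy_le.trans hε_lt.le

theorem exists_one_add_mul_weight_le (ha : 0 < a) {t : ℝ} (ht : 1 < t) {ε : ℝ} (hε : 0 < ε) :
    ∃ κ > 0, ∀ ν, (1 + κ) * weight a ν
      ≤ weight a (t⁻¹ * ν) + κ * (Icc (-ε) ε).indicator (weight a) ν := by
  obtain ⟨κ, hκ, weight_gain⟩ := exists_mul_weight_le ha ht hε
  refine ⟨κ, hκ, fun ν => ?_⟩
  by_cases hν : ν ∈ Icc (-ε) ε
  · rw [indicator_of_mem hν, add_mul, one_mul]
    gcongr
    exact weight_le_weight_inv_mul ha ht ν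
  · rw [indicator_of_notMem hν, mul_zero, add_zero]
    exact weight_gain ν (not_le.1 fun h => hν (abs_le.1 h)).le

-- Low frequencies contribute less than `maxEnergy a s`, while dilation by `t` increases the weight
-- at all other frequencies by a definite factor.
theorem mul_maxEnergy_lt (ha : 0 < a) (hs : 0 < s) {t : ℝ} (ht : 1 < t) :
    t * maxEnergy a s < maxEnergy a (t * s) := by
  have ht0 : 0 < t := by linarith
  obtain ⟨b, hsb, hb_lt⟩ := exists_between (lt_maxEnergy ha.le hs)
  obtain ⟨ε, hε, low_le⟩ := exists_low_frequency_energy_le ha.le hsb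
  obtain ⟨κ, hκ, weight_le⟩ := exists_one_add_mul_weight_le ha ht hε
  have sup_le : maxEnergy a s ≤ (maxEnergy a (t * s) / t + κ * b) / (1 + κ) := by
    refine maxEnergy_le hs.le fun g hg => (le_div_iff₀' (by linarith)).2 ?_
    have dilated_le := (le_div_iff₀' ht0).2 (hg.mul_spectralEnergy_le_maxEnergy ha.le ht0)
    exact (mul_spectralEnergy_le_add (by linarith) (fun ν => (weight_mem ha.le ν).1)
      (measurable_weight_inv_mul a t) (fun ν => weight_mem ha.le _)
      ((measurable_weight a).indicator measurableSet_Icc) (indicator_weight_mem ha.le _) weight_le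
      hg.integrable_ofReal hg.memLp_ofReal).trans
        (add_le_add dilated_le (mul_le_mul_of_nonneg_left (low_le g hg) hκ.le))
  rw [le_div_iff₀' (by linarith)] at sup_le
  rw [← lt_div_iff₀' ht0]
  nlinarith

theorem eventually_maxEnergy_le (ha : 0 < a) {b : ℝ} (hb : 1 < b) :
    ∀ᶠ s in 𝓝[>] 0, maxEnergy a s ≤ b * s := by
  obtain ⟨δ, hδ_lt, hδ⟩ := exists_one_add_two_mul_mul_lt hb
  have hcont : ContinuousAt (fun s : ℝ => 1 + 2 * δ
      + (1 + δ⁻¹) * (2 * √s * (3 / δ) ^ 2 + √s ^ (2 * a) * 3)) 0 := by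
    have := Real.continuous_sqrt.rpow_const fun _ => Or.inr (by positivity : 0 ≤ 2 * a)
    fun_prop
  have value_at_zero : 1 + 2 * δ
      + (1 + δ⁻¹) * (2 * √0 * (3 / δ) ^ 2 + √0 ^ (2 * a) * 3) < b := by
    rwa [Real.sqrt_zero, Real.zero_rpow (by positivity), mul_zero, zero_mul, zero_mul, add_zero,
      mul_zero, add_zero, ← mul_one (1 + 2 * δ)]
  filter_upwards [eventually_nhdsGT_zero_lt hcont value_at_zero, self_mem_nhdsWithin]
    with s hs_lt hs
  have hsqrt : 0 < √s := Real.sqrt_pos.2 hs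
  refine maxEnergy_le (le_of_lt hs) fun g hg => ?_
  have energy_le := hg.spectralEnergy_le (measurable_weight a) (weight_mem ha.le)
    (K := Icc (-(√s)⁻¹) (√s)⁻¹) (θ := √s ^ (2 * a)) measurableSet_Icc measure_Icc_lt_top.ne
    (by positivity) (fun ν hν => ?_) hδ
  · rw [Real.volume_real_Icc_of_le (by linarith [inv_pos.2 hsqrt]), sub_neg_eq_add, ← two_mul]
      at energy_le
    refine energy_le.trans (le_trans (le_of_eq ?_)
      (mul_le_mul_of_nonneg_right hs_lt.le (le_of_lt hs)))
    have s_sq : s ^ 2 = √s * √s * s := by rw [Real.mul_self_sqrt (le_of_lt hs), sq]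
    rw [mul_pow _ s, s_sq]
    field_simp
  · have outside : (√s)⁻¹ ≤ |ν| := (not_le.1 fun h => hν (abs_le.1 h)).le
    exact (weight_le_of_le_abs ha.le (inv_pos.2 hsqrt) outside).trans_eq (by rw [inv_inv])

theorem maxEnergy_div_lt (ha : 0 < a) (hs : 0 < s) {s' : ℝ} (h : s < s') :
    maxEnergy a s / s < maxEnergy a s' / s' := by
  have dilated_lt := mul_maxEnergy_lt ha hs ((one_lt_div hs).2 h)
  rw [div_mul_cancel₀ _ hs.ne', div_mul_eq_mul_div, mul_div_assoc] at dilated_lt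
  exact (lt_div_iff₀' (hs.trans h)).2 dilated_lt

theorem maxEnergy_div_le (ha : 0 ≤ a) (hs : 0 < s) {s' : ℝ} (h : s ≤ s') :
    maxEnergy a s' / s' ≤ (s' / s) ^ (2 * a) * (maxEnergy a s / s) := by
  have dilated_le := maxEnergy_mul_le ha hs.le ((one_le_div hs).2 h)
  rw [div_mul_cancel₀ _ hs.ne'] at dilated_le
  rw [div_le_iff₀ (hs.trans_le h)]
  exact dilated_le.trans_eq (by ring)

theorem continuousOn_Ioi_of_monotoneOn_of_le_rpow_mul {F : ℝ → ℝ} {p : ℝ}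
    (hF : MonotoneOn F (Ioi 0))
    (hle : ∀ s s', 0 < s → s ≤ s' → F s' ≤ (s' / s) ^ p * F s) : ContinuousOn F (Ioi 0) := by
  intro s₀ (hs₀ : 0 < s₀)
  have rescaled : Tendsto (fun s => (s / s₀) ^ p * F s₀) (𝓝 s₀) (𝓝 (F s₀)) := by
    have base : ContinuousAt (fun s => s / s₀) s₀ := by fun_prop
    have h := (base.rpow_const (p := p) (Or.inl (div_self hs₀.ne' ▸ one_ne_zero))).mul_const (F s₀)
    simpa only [ContinuousAt, div_self hs₀.ne', Real.one_rpow, one_mul] using h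
  have lower := rescaled.min (tendsto_const_nhds (x := F s₀))
  have upper := rescaled.max (tendsto_const_nhds (x := F s₀))
  rw [min_self] at lower
  rw [max_self] at upper
  have between : ∀ᶠ s in 𝓝 s₀, min ((s / s₀) ^ p * F s₀) (F s₀) ≤ F s ∧
      F s ≤ max ((s / s₀) ^ p * F s₀) (F s₀) := by
    filter_upwards [Ioi_mem_nhds hs₀] with s (hs : 0 < s)
    rcases le_total s s₀ with h | h
    · refine ⟨min_le_of_left_le ?_, le_max_of_le_right (hF hs hs₀ h)⟩
      rw [← inv_div, Real.inv_rpow (by positivity), inv_mul_le_iff₀ (by positivity)]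
      exact hle s s₀ hs h
    · exact ⟨min_le_of_right_le (hF hs₀ hs h), le_max_of_le_left (hle s₀ s hs₀ h)⟩
  exact (tendsto_of_tendsto_of_tendsto_of_le_of_le' lower upper
    (between.mono fun _ h => h.1) (between.mono fun _ h => h.2)).mono_left nhdsWithin_le_nhds

theorem continuousOn_maxEnergy_div (ha : 0 < a) :
    ContinuousOn (fun s => maxEnergy a s / s) (Ioi 0) :=
  continuousOn_Ioi_of_monotoneOn_of_le_rpow_mul
    (StrictMonoOn.monotoneOn fun _ hs _ _ h => maxEnergy_div_lt ha hs h)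
    fun _ _ hs h => maxEnergy_div_le ha.le hs h

theorem tendsto_maxEnergy_div_nhdsGT_zero (ha : 0 < a) :
    Tendsto (fun s => maxEnergy a s / s) (𝓝[>] 0) (𝓝 1) := by
  refine tendsto_order.2 ⟨fun b hb => ?_, fun b hb => ?_⟩
  · filter_upwards [self_mem_nhdsWithin] with s hs
    exact hb.trans ((one_lt_div hs).2 (lt_maxEnergy ha.le hs))
  · obtain ⟨c, hc, hcb⟩ := exists_between hb
    filter_upwards [self_mem_nhdsWithin, eventually_maxEnergy_le ha hc] with s hs h
    exact ((div_le_iff₀ hs).2 h).trans_lt hcb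

theorem tendsto_maxEnergy_div_atTop (ha : 0 ≤ a) :
    Tendsto (fun s => maxEnergy a s / s) atTop (𝓝 maxRatio) := by
  have lower : Tendsto (fun s : ℝ => maxRatio - (4 * a + 1) * Real.pi * B ^ 2 / s) atTop
      (𝓝 maxRatio) := by
    simpa only [sub_zero, id] using (tendsto_const_nhds (x := maxRatio)).sub
      ((tendsto_const_nhds (x := (4 * a + 1) * Real.pi * B ^ 2)).div_atTop tendsto_id)
  refine tendsto_of_tendsto_of_tendsto_of_le_of_le' lower tendsto_const_nhds ?_ ?_ <;>
    filter_upwards [eventually_gt_atTop 0] with s hs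
  · have indicator_le := sq_div_Psi_mul_sub_le_maxEnergy ha hs.le (by linarith [B_mem.1] : 0 < B)
    rw [← maxRatio_eq] at indicator_le
    rwa [le_div_iff₀ hs, sub_mul, div_mul_cancel₀ _ hs.ne']
  · exact (div_le_iff₀ hs).2 (maxEnergy_le_maxRatio_mul ha hs.le)

end MaxEnergy

/-! ### The supremum over the unit sphere of the gauge norm -/

section ConvNorm

variable {a : ℝ} (ha : 0 ≤ a)

theorem norm_convK_sq (f : Lp ℂ 2 (volume : Measure ℝ)) :
    ‖convK a ha f‖ ^ 2 = ∫ ν, weight a ν * ‖(𝓕 f : Lp ℂ 2 (volume : Measure ℝ)) ν‖ ^ 2 := by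
  have isometry : ‖convK a ha f‖
      = ‖((memLp_symbol ha).toLp _ • 𝓕 f : Lp ℂ 2 (volume : Measure ℝ))‖ :=
    (Lp.fourierTransformₗᵢ ℝ ℂ).symm.norm_map _
  rw [isometry, norm_sq_eq_integral_norm_sq]
  refine integral_congr_ae ?_
  filter_upwards [Lp.coeFn_lpSMul (r := 2) ((memLp_symbol ha).toLp _) (𝓕 f),
    (memLp_symbol ha).coeFn_toLp] with ν smul_apply symbol_apply
  rw [smul_apply, Pi.smul_apply', symbol_apply, norm_smul, mul_pow, Complex.norm_real,
    Real.norm_eq_abs, sq_abs, weight]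

theorem norm_convK_le (f : Lp ℂ 2 (volume : Measure ℝ)) : ‖convK a ha f‖ ≤ ‖f‖ := by
  refine le_of_sq_le_sq ?_ (norm_nonneg f)
  rw [norm_convK_sq, ← Lp.norm_fourier_eq f, norm_sq_eq_integral_norm_sq]
  exact integral_mono_of_nonneg
    (Eventually.of_forall fun ν => mul_nonneg (weight_mem ha ν).1 (sq_nonneg _))
    (Lp.memLp _).norm.integrable_sq
    (Eventually.of_forall fun ν => mul_le_of_le_one_left (sq_nonneg _) (weight_mem ha ν).2)

theorem convK_smul (c : ℂ) (f : Lp ℂ 2 (volume : Measure ℝ)) :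
    convK a ha (c • f) = c • convK a ha f := by
  unfold convK
  rw [FourierTransform.fourier_smul, ← Lp.smul_comm, FourierTransform.fourierInv_smul]

theorem convK_sub (f g : Lp ℂ 2 (volume : Measure ℝ)) :
    convK a ha (f - g) = convK a ha f - convK a ha g := by
  unfold convK
  rw [sub_eq_add_neg, FourierTransform.fourier_add, Lp.add_smul, FourierTransform.fourierInv_add,
    FourierTransform.fourier_neg, Lp.smul_neg, FourierTransform.fourierInv_neg, sub_eq_add_neg]

theorem norm_convK_toLp_sq {f : ℝ → ℂ} (h1 : Integrable f) (h2 : MemLp f 2 volume) :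
    ‖convK a ha (h2.toLp f)‖ ^ 2 = spectralEnergy (weight a) f := by
  rw [norm_convK_sq]
  exact integral_congr_ae ((fourier_toLp_ae_eq h1 h2).mono fun ν hν => by simp only [hν])

/-- The norm `‖K_a * f‖` in `L²`, for real-valued `f ∈ L²`. -/
def convNorm {f : ℝ → ℝ} (hf : MemLp f 2 (volume : Measure ℝ)) : ℝ :=
  ‖convK a ha ((hf.ofReal (K := ℂ)).toLp _)‖

variable {f g : ℝ → ℝ}

theorem convNorm_nonneg (hf : MemLp f 2 (volume : Measure ℝ)) : 0 ≤ convNorm ha hf :=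
  norm_nonneg _

theorem memLp_div {X : Type*} [MeasurableSpace X] {μ : Measure X} {p : ℝ≥0∞} {f : X → ℝ}
    (hf : MemLp f p μ) (l : ℝ) : MemLp (fun x => f x / l) p μ := by
  simpa only [div_eq_mul_inv] using hf.mul_const l⁻¹

theorem convNorm_div (hf : MemLp f 2 (volume : Measure ℝ)) {l : ℝ} (hl : 0 < l) :
    convNorm ha (memLp_div hf l) = convNorm ha hf / l := by
  have toLp_div : ((memLp_div hf l).ofReal (K := ℂ)).toLp _
      = (l⁻¹ : ℂ) • (hf.ofReal (K := ℂ)).toLp _ := by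
    rw [← MemLp.toLp_const_smul]
    refine MemLp.toLp_congr _ _ (Eventually.of_forall fun x => ?_)
    simp only [div_eq_inv_mul, Pi.smul_apply, smul_eq_mul]
    exact (Complex.ofReal_mul _ _).trans (congrArg (· * (f x : ℂ)) (Complex.ofReal_inv l))
  rw [convNorm, toLp_div, convK_smul, norm_smul, norm_inv, Complex.norm_real,
    Real.norm_of_nonneg hl.le, convNorm, inv_mul_eq_div]

theorem convNorm_le_add (hf : MemLp f 2 (volume : Measure ℝ))
    (hg : MemLp g 2 (volume : Measure ℝ)) :
    convNorm ha hf ≤ convNorm ha hg + (eLpNorm (f - g) 2 volume).toReal := by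
  have norm_toLp_sub : ‖(hf.ofReal (K := ℂ)).toLp _ - (hg.ofReal (K := ℂ)).toLp _‖
      = (eLpNorm (f - g) 2 volume).toReal := by
    rw [← MemLp.toLp_sub, Lp.norm_toLp]
    congr 1
    refine eLpNorm_congr_norm_ae (Eventually.of_forall fun x => ?_)
    rw [Pi.sub_apply, ← RCLike.ofReal_sub, RCLike.norm_ofReal, Pi.sub_apply, Real.norm_eq_abs]
  rw [← norm_toLp_sub]
  refine (norm_le_norm_add_norm_sub' _ (convK a ha ((hg.ofReal (K := ℂ)).toLp _))).trans ?_
  rw [← convK_sub]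
  exact add_le_add le_rfl (norm_convK_le ha _)

theorem IsAdmissible.convNorm_sq {s : ℝ} (hg : IsAdmissible volume s g) :
    convNorm ha hg.memLp ^ 2 = spectralEnergy (weight a) fun x => (g x : ℂ) :=
  norm_convK_toLp_sq ha hg.integrable_ofReal hg.memLp_ofReal

theorem isAdmissible_div_iff {X : Type*} [MeasurableSpace X] {μ : Measure X} {α : ℝ} (hα : 0 < α)
    {f : X → ℝ} : IsAdmissible μ (α ^ 3)⁻¹ (fun x => f x / α) ↔
      Integrable f μ ∧ ∫⁻ x, ENNReal.ofReal (Psi α (f x)) ∂μ ≤ 1 := by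
  have Psi_div : ∀ x, Psi α (f x) = α ^ 3 * Psi 1 (f x / α) := fun x => by
    rw [← Psi_mul hα, mul_div_cancel₀ _ hα.ne']
  constructor
  · intro h
    have integrable_Psi : Integrable (fun x => Psi α (f x)) μ := by
      simpa only [Psi_div] using h.integrable_Psi.const_mul (α ^ 3)
    refine ⟨by simpa only [div_mul_cancel₀ _ hα.ne'] using h.integrable.mul_const α, ?_⟩
    rw [← ofReal_integral_eq_lintegral_ofReal integrable_Psi
      (Eventually.of_forall fun x => Psi_nonneg hα _), ENNReal.ofReal_le_one]
    simp only [Psi_div]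
    rw [integral_const_mul, ← le_div_iff₀' (by positivity), one_div]
    exact h.integral_Psi_le
  · rintro ⟨integrable, modular_le⟩
    obtain ⟨integrable_Psi, integral_le⟩ :=
      integrable_Psi_and_integral_le_one hα integrable.1 modular_le
    simp only [Psi_div] at integrable_Psi integral_le
    rw [integral_const_mul, ← le_div_iff₀' (by positivity), one_div] at integral_le
    exact ⟨integrable.div_const α, (integrable_const_mul_iff
      (pow_pos hα 3).ne'.isUnit _).1 integrable_Psi, integral_le⟩

theorem convNorm_le_of_integrable {α : ℝ} (hα : 0 < α) (hf1 : Integrable f)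
    (hf : MemLp f 2 (volume : Measure ℝ)) (h : ∫⁻ x, ENNReal.ofReal (Psi α (f x)) ≤ 1) :
    convNorm ha hf ≤ α * √(maxEnergy a (α ^ 3)⁻¹) := by
  have admissible := (isAdmissible_div_iff hα).2 ⟨hf1, h⟩
  rw [← div_le_iff₀' hα, ← convNorm_div ha hf hα]
  refine Real.le_sqrt_of_sq_le ?_
  rw [admissible.convNorm_sq ha]
  exact admissible.spectralEnergy_le_maxEnergy ha

theorem lintegral_Psi_indicator_le {X : Type*} [MeasurableSpace X] {μ : Measure X} {α : ℝ}
    (hα : 0 < α) (A : Set X) (f : X → ℝ) :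
    ∫⁻ x, ENNReal.ofReal (Psi α (A.indicator f x)) ∂μ
      ≤ ∫⁻ x, ENNReal.ofReal (Psi α (f x)) ∂μ := by
  simp only [Psi_indicator hα]
  exact lintegral_mono fun x =>
    ENNReal.ofReal_le_ofReal (indicator_le_self' (fun _ _ => Psi_nonneg hα _) x)

theorem convNorm_le_of_lintegral_Psi_le_one {α : ℝ} (hα : 0 < α)
    (hf : MemLp f 2 (volume : Measure ℝ)) (h : ∫⁻ x, ENNReal.ofReal (Psi α (f x)) ≤ 1) :
    convNorm ha hf ≤ α * √(maxEnergy a (α ^ 3)⁻¹) := by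
  refine le_of_forall_pos_le_add fun ε hε => ?_
  obtain ⟨A, hA, hA_fin, hA_lt⟩ := hf.exists_eLpNorm_indicator_compl_lt (by norm_num)
    (ENNReal.ofReal_pos.2 hε).ne'
  have truncated_integrable : Integrable (A.indicator f) := by
    have : IsFiniteMeasure (volume.restrict A) := ⟨by rwa [Measure.restrict_apply_univ]⟩
    exact (integrable_indicator_iff hA).2 ((hf.restrict A).integrable one_le_two)
  refine (convNorm_le_add ha hf (hf.indicator hA)).trans (add_le_add
    (convNorm_le_of_integrable ha hα truncated_integrable (hf.indicator hA)
      ((lintegral_Psi_indicator_le hα A f).trans h)) ?_)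
  rw [← indicator_compl]
  exact ENNReal.toReal_le_of_le_ofReal hε.le hA_lt.le

theorem convNorm_le_mul_gaugeNorm {α : ℝ} (hα : 0 < α) (hf : MemLp f 2 (volume : Measure ℝ))
    (h : {l : ℝ | 0 < l ∧ ∫⁻ x, ENNReal.ofReal (Psi α (f x / l)) ≤ 1}.Nonempty) :
    convNorm ha hf ≤ α * √(maxEnergy a (α ^ 3)⁻¹) * gaugeNorm (Psi α) f := by
  have hs : 0 < (α ^ 3)⁻¹ := by positivity
  have hC : 0 < α * √(maxEnergy a (α ^ 3)⁻¹) :=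
    mul_pos hα (Real.sqrt_pos.2 (hs.trans (lt_maxEnergy ha hs)))
  rw [← div_le_iff₀' hC]
  refine le_csInf h fun l ⟨hl, modular_le⟩ => ?_
  rw [div_le_iff₀' hC, ← div_le_iff₀ hl, ← convNorm_div ha hf hl]
  exact convNorm_le_of_lintegral_Psi_le_one ha hα (memLp_div hf l) modular_le

open scoped Pointwise in
theorem gaugeNorm_div (Ψ f : ℝ → ℝ) {N : ℝ} (hN : 0 < N) :
    gaugeNorm Ψ (fun x => f x / N) = gaugeNorm Ψ f / N := by
  have rescaled : {l : ℝ | 0 < l ∧ ∫⁻ x, ENNReal.ofReal (Ψ (f x / N / l)) ≤ 1}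
      = N⁻¹ • {l : ℝ | 0 < l ∧ ∫⁻ x, ENNReal.ofReal (Ψ (f x / l)) ≤ 1} := by
    ext l
    rw [mem_inv_smul_set_iff₀ hN.ne']
    simp only [mem_ofPred_eq, smul_eq_mul, div_div, mul_pos_iff_of_pos_left hN]
  rw [gaugeNorm, rescaled, Real.sInf_smul_of_nonneg (inv_nonneg.2 hN.le), smul_eq_mul,
    inv_mul_eq_div, gaugeNorm]

/-- The variational quantity `J` with the kernel `K_a` in place of `K_{1/4}`. -/
def supConvNorm (α : ℝ) : ℝ :=
  sSup {r : ℝ | ∃ (f : ℝ → ℝ) (hf : MemLp f 2 (volume : Measure ℝ)),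
    MemOrlicz (Psi α) f ∧ gaugeNorm (Psi α) f = 1 ∧ r = convNorm ha hf}

theorem convNorm_le_of_gaugeNorm_eq_one {α : ℝ} (hα : 0 < α)
    (hf : MemLp f 2 (volume : Measure ℝ)) (h : gaugeNorm (Psi α) f = 1) :
    convNorm ha hf ≤ α * √(maxEnergy a (α ^ 3)⁻¹) := by
  refine (convNorm_le_mul_gaugeNorm ha hα hf ?_).trans_eq (by rw [h, mul_one])
  by_contra! empty
  rw [gaugeNorm, empty, Real.sInf_empty] at h
  exact zero_ne_one h

theorem convNorm_le_supConvNorm {α : ℝ} (hα : 0 < α) (hf : MemLp f 2 (volume : Measure ℝ))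
    (h : ∫⁻ x, ENNReal.ofReal (Psi α (f x)) ≤ 1) : convNorm ha hf ≤ supConvNorm ha α := by
  rcases (convNorm_nonneg ha hf).eq_or_lt with norm_zero | norm_pos
  · rw [← norm_zero]
    refine Real.sSup_nonneg ?_
    rintro _ ⟨f, hf, -, -, rfl⟩
    exact convNorm_nonneg ha hf
  have one_mem : (1 : ℝ) ∈ {l : ℝ | 0 < l ∧ ∫⁻ x, ENNReal.ofReal (Psi α (f x / l)) ≤ 1} :=
    ⟨one_pos, by simpa only [div_one] using h⟩
  have gauge_pos : 0 < gaugeNorm (Psi α) f :=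
    pos_of_mul_pos_right (norm_pos.trans_le (convNorm_le_mul_gaugeNorm ha hα hf ⟨1, one_mem⟩))
      (by positivity)
  have gauge_le_one : gaugeNorm (Psi α) f ≤ 1 := csInf_le ⟨0, fun l hl => hl.1.le⟩ one_mem
  refine (le_div_self norm_pos.le gauge_pos gauge_le_one).trans ?_
  rw [← convNorm_div ha hf gauge_pos]
  refine le_csSup ⟨α * √(maxEnergy a (α ^ 3)⁻¹), ?_⟩ ⟨_, memLp_div hf _,
    ⟨(memLp_div hf _).1, gaugeNorm (Psi α) f, gauge_pos, ?_⟩, ?_, rfl⟩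
  · rintro _ ⟨f, hf, -, h, rfl⟩
    exact convNorm_le_of_gaugeNorm_eq_one ha hα hf h
  · simp only [mul_div_cancel₀ _ gauge_pos.ne']
    exact h.trans_lt ENNReal.one_lt_top
  · rw [gaugeNorm_div _ _ gauge_pos, div_self gauge_pos.ne']

theorem supConvNorm_eq {α : ℝ} (hα : 0 < α) :
    supConvNorm ha α = α * √(maxEnergy a (α ^ 3)⁻¹) := by
  refine le_antisymm (Real.sSup_le ?_ (by positivity)) ?_
  · rintro _ ⟨f, hf, -, h, rfl⟩
    exact convNorm_le_of_gaugeNorm_eq_one ha hα hf h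
  have div_bound : ∀ g (hg : IsAdmissible volume (α ^ 3)⁻¹ g),
      convNorm ha hg.memLp ≤ supConvNorm ha α / α := fun g hg => by
    have hf : MemLp (fun x => α * g x) 2 volume := hg.memLp.const_mul α
    have g_eq : g = fun x => α * g x / α := funext fun x => (mul_div_cancel_left₀ _ hα.ne').symm
    have modular_le := ((isAdmissible_div_iff hα).1 (g_eq ▸ hg)).2
    have convNorm_eq := convNorm_div ha hf hα
    simp only [mul_div_cancel_left₀ _ hα.ne'] at convNorm_eq
    rw [convNorm_eq]
    exact div_le_div_of_nonneg_right (convNorm_le_supConvNorm ha hα hf modular_le) hα.le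
  have sup_nonneg : 0 ≤ supConvNorm ha α / α :=
    (convNorm_nonneg ha _).trans (div_bound _ (IsAdmissible.zero (by positivity)))
  rw [← le_div_iff₀' hα]
  refine Real.sqrt_le_iff.2 ⟨sup_nonneg, maxEnergy_le (by positivity) fun g hg => ?_⟩
  rw [← hg.convNorm_sq ha]
  exact pow_le_pow_left₀ (convNorm_nonneg ha _) (div_bound g hg) 2

theorem mul_supConvNorm_sq {α : ℝ} (hα : 0 < α) :
    α * supConvNorm ha α ^ 2 = maxEnergy a (α ^ 3)⁻¹ / (α ^ 3)⁻¹ := by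
  have hs : 0 < (α ^ 3)⁻¹ := by positivity
  rw [supConvNorm_eq ha hα, mul_pow, Real.sq_sqrt (hs.trans (lt_maxEnergy ha hs)).le,
    div_inv_eq_mul]
  ring

end ConvNorm

/-! ### The limits -/

theorem tendsto_inv_pow_three_atTop :
    Tendsto (fun α : ℝ => (α ^ 3)⁻¹) atTop (𝓝[>] 0) :=
  tendsto_inv_atTop_nhdsGT_zero.comp (tendsto_pow_atTop three_ne_zero)

theorem tendsto_inv_pow_three_nhdsGT_zero :
    Tendsto (fun α : ℝ => (α ^ 3)⁻¹) (𝓝[>] 0) atTop := by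
  simp only [← inv_pow]
  exact (tendsto_pow_atTop three_ne_zero).comp tendsto_inv_nhdsGT_zero

theorem continuousOn_inv_pow_three : ContinuousOn (fun α : ℝ => (α ^ 3)⁻¹) (Ioi 0) :=
  (continuous_pow 3).continuousOn.inv₀ fun _ hα => (pow_pos hα 3).ne'

theorem mainTheorem5_general {a : ℝ} (ha : 0 < a) :
    ContinuousOn (fun α : ℝ => α * supConvNorm ha.le α ^ 2) (Ioi 0) ∧
    StrictAntiOn (fun α : ℝ => α * supConvNorm ha.le α ^ 2) (Ioi 0) ∧
    Tendsto (fun α : ℝ => α * supConvNorm ha.le α ^ 2) atTop (𝓝 1) ∧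
    Tendsto (fun α : ℝ => α * supConvNorm ha.le α ^ 2) (𝓝[>] 0)
      (𝓝 (3 * B ^ 2 / (2 + 3 * (B - 1) + 3 * (B - 1) ^ 3))) ∧
    3 / 2 < 3 * B ^ 2 / (2 + 3 * (B - 1) + 3 * (B - 1) ^ 3) ∧
    |B - 1.48| < 0.005 := by
  have ratio_eq : EqOn (fun α : ℝ => α * supConvNorm ha.le α ^ 2)
      ((fun s => maxEnergy a s / s) ∘ fun α : ℝ => (α ^ 3)⁻¹) (Ioi 0) :=
    fun α hα => mul_supConvNorm_sq ha.le hα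
  refine ⟨?_, ?_, ?_, ?_, three_halves_lt_maxRatio, ?_⟩
  · exact ((continuousOn_maxEnergy_div ha).comp continuousOn_inv_pow_three
      fun α hα => mem_Ioi.2 (inv_pos.2 (pow_pos hα 3))).congr ratio_eq
  · refine StrictAntiOn.congr (fun α (hα : 0 < α) β (hβ : 0 < β) hlt => ?_) ratio_eq.symm
    exact maxEnergy_div_lt ha (by positivity)
      (inv_strictAnti₀ (by positivity) (pow_lt_pow_left₀ hlt hα.le three_ne_zero))
  · exact ((tendsto_maxEnergy_div_nhdsGT_zero ha).comp tendsto_inv_pow_three_atTop).congr'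
      (ratio_eq.symm.eventuallyEq_of_mem (Ioi_mem_atTop 0))
  · exact ((tendsto_maxEnergy_div_atTop ha.le).comp tendsto_inv_pow_three_nhdsGT_zero).congr'
      (ratio_eq.symm.eventuallyEq_of_mem self_mem_nhdsWithin)
  · obtain ⟨lower, upper⟩ := B_mem
    exact abs_lt.2 ⟨by linarith, by linarith⟩

end

end Whitham

theorem mainTheorem5 :
    ContinuousOn (fun α : ℝ => α * Whitham.J α ^ 2) (Set.Ioi 0) ∧
    StrictAntiOn (fun α : ℝ => α * Whitham.J α ^ 2) (Set.Ioi 0) ∧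
    Filter.Tendsto (fun α : ℝ => α * Whitham.J α ^ 2) Filter.atTop (nhds 1) ∧
    Filter.Tendsto (fun α : ℝ => α * Whitham.J α ^ 2) (nhdsWithin 0 (Set.Ioi 0))
      (nhds (3 * Whitham.B ^ 2 / (2 + 3 * (Whitham.B - 1) + 3 * (Whitham.B - 1) ^ 3))) ∧
    3 / 2 < 3 * Whitham.B ^ 2 / (2 + 3 * (Whitham.B - 1) + 3 * (Whitham.B - 1) ^ 3) ∧
    |Whitham.B - 1.48| < 0.005 :=
  Whitham.mainTheorem5_general (a := 1 / 4) (by norm_num)
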